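/- Let $d,\delta$ be positive integers with $\delta\le d$ and let $g\in\mathbb{N}\cup\{\infty\}$. Let $\mathcal{K}$ be the class of all countable (finite or countably infinite, not necessarily connected) $d$-regular simple graphs $G$ such that for every $k<g$ every vertex of $G$ lies on at most $\left(\frac{d}{12\delta}\right)^k$ cycles of length $k$. Then: (1) every $G\in\mathcal{K}$ has a spanning subgraph $H$ with girth at least $g$ and minimum degree at least $\delta$ (the girth of an acyclic graph is $\infty$); (2) there is a randomized local Borel function $\varphi$, depending only on $d,\delta,g$, that gives such a subgraph almost surely on every graph in $\mathcal{K}$. Here $\mathcal{F}_d$ denotes the space of pairs $(G,f)$, where $G$ is a connected rooted graph with maximum degree at most $d$ and $f\in[0,1]^{V(G)}$. Its Borel sets are the elements of the $\sigma$-algebra generated by the sets of all $(G,f)$ for which there are an $r$ and an isomorphism from the rooted $r$-ball of $G$ to a given finite rooted graph $K$ carrying the restriction of $f$ to an element of a given Borel set $B\subseteq[0,1]^{V(K)}$. A randomized local Borel function is a Borel map from $\mathcal{F}_d$ to a topological space, here the finite discrete space of subsets of $\{0,\dots,d-1\}$. Given $G\in\mathcal{K}$ and labels $f\in[0,1]^{V(G)}$,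 evaluate $\varphi$ at every vertex $x$, on the connected component of $x$ rooted at $x$ with the restricted labels; the value is the set of neighbours of $x$ whose positions, in increasing order of the labels and counted from $0$, belong to it. Statement (2) says that for every $G\in\mathcal{K}$ and almost every $f$ with respect to the product of the Lebesgue measures, there is a spanning subgraph $H$ of $G$ with girth at least $g$ and minimum degree at least $\delta$ in which the set of neighbours of every vertex $x$ is the set given by $\varphi$ at $x$. -/

import Mathlib

universe u

/-- A point of the space of labelled rooted graphs with degree bound `b`: a connected rooted
(simple) graph all of whose degrees are at most `b`, with a label in `[0,1]` at every vertex. -/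
structure LabeledRootedGraph (b : ℕ) where
  /-- the vertex set -/
  V : Type u
  /-- the graph -/
  graph : SimpleGraph V
  /-- the root -/
  root : V
  /-- the labelling -/
  label : V → unitInterval
  connected : graph.Connected
  degree_le : ∀ v, (graph.neighborSet v).encard ≤ b

namespace LabeledRootedGraph

/-- The vertex set of the ball of radius `r` around the root. -/
def ball {b : ℕ} (X : LabeledRootedGraph b) (r : ℕ) : Set X.V :=
  {v | X.graph.dist X.root v ≤ r}

/-- The set of those labelled rooted graphs for which, for some `r`, the rooted ball of radius `r`
is isomorphic to the finite rooted graph `(K, o)` by an isomorphism that carries the labels of the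
ball to an element of `B`. (It is empty if `K` is not connected or has a degree above `b`.) -/
def cylinder (b : ℕ) {n : ℕ} (K : SimpleGraph (Fin n)) (o : Fin n)
    (B : Set (Fin n → unitInterval)) : Set (LabeledRootedGraph b) :=
  {X | ∃ (r : ℕ) (e : X.graph.induce (X.ball r) ≃g K),
    (e.symm o : X.V) = X.root ∧ (fun i => X.label (e.symm i : X.V)) ∈ B}

/-- The Borel sets of labelled rooted graphs: the σ-algebra generated by the cylinders over
Borel sets. -/
instance (b : ℕ) : MeasurableSpace (LabeledRootedGraph b) :=
  MeasurableSpace.generateFrom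
    {S | ∃ (n : ℕ) (K : SimpleGraph (Fin n)) (o : Fin n) (B : Set (Fin n → unitInterval)),
      MeasurableSet B ∧ S = cylinder b K o B}

end LabeledRootedGraph

/-- A randomized local Borel function with values in a topological space `C`: a Borel mapping from
the labelled rooted graphs with degree bound `b` to `C`. -/
def IsRandomizedLocalBorel {b : ℕ} {C : Type*} [TopologicalSpace C]
    (φ : LabeledRootedGraph b → C) : Prop :=
  @Measurable _ _ inferInstance (borel C) φ

namespace SimpleGraph

/-- The connected component of the vertex `x` of `G`, rooted at `x`, with the restriction of the
labelling `f`. -/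
def rootedComponent {V : Type*} (G : SimpleGraph V) {b : ℕ}
    (hG : ∀ v, (G.neighborSet v).encard ≤ b) (f : V → unitInterval) (x : V) :
    LabeledRootedGraph b where
  V := (G.connectedComponentMk x).supp
  graph := (G.connectedComponentMk x).toSimpleGraph
  root := ⟨x, rfl⟩
  label := fun v => f v
  connected := (G.connectedComponentMk x).connected_toSimpleGraph
  degree_le := fun v => by
    refine le_trans ?_ (hG v)
    rw [← Subtype.val_injective.encard_image]
    refine Set.encard_le_encard ?_
    rintro _ ⟨w, hw, rfl⟩
    exact hw

/-- The number of neighbours of `x` whose label is smaller than that of `y`: if the labels are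
distinct, this is the position (counted from `0`) of the neighbour `y` of `x` in the list of the
neighbours of `x` in increasing order of labels. -/
noncomputable def neighborRank {V : Type*} (G : SimpleGraph V) (f : V → unitInterval)
    (x y : V) : ℕ :=
  {z | G.Adj x z ∧ f z < f y}.ncard

/-- Let `φ` assign to every labelled rooted graph a set of positions `i < b`, given by its
indicator function. `H` is the graph given by `φ` on `G` with the labels `f` if the `H`-neighbours
of every vertex `x` are exactly those `G`-neighbours of `x` whose position in the list of
neighbours of `x` belongs to the set that `φ` assigns to `x`. -/
def IsGivenBy {V : Type*} (G : SimpleGraph V) {b : ℕ} (hG : ∀ v, (G.neighborSet v).encard ≤ b)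
    (φ : LabeledRootedGraph b → (Fin b → Bool)) (f : V → unitInterval) (H : SimpleGraph V) : Prop :=
  ∀ x y, H.Adj x y ↔ G.Adj x y ∧
    ∃ i : Fin b, (i : ℕ) = G.neighborRank f x y ∧ φ (G.rootedComponent hG f x) i = true

/-- The cycles of length `k` of `G` that contain the vertex `x`, as subgraphs of `G`. -/
def cyclesThrough {V : Type*} (G : SimpleGraph V) (x : V) (k : ℕ) : Set G.Subgraph :=
  {C | ∃ p : G.Walk x x, p.IsCycle ∧ p.length = k ∧ p.toSubgraph = C}

theorem IsRegularOfDegree.encard_neighborSet_le {V : Type*} {G : SimpleGraph V} [G.LocallyFinite]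
    {d : ℕ} (hG : G.IsRegularOfDegree d) (v : V) : (G.neighborSet v).encard ≤ d := by
  rw [Set.encard_eq_coe_toFinset_card, ← neighborFinset_def, card_neighborFinset_eq_degree, hG v]

/-- For every `k < g`, every vertex lies on at most `(d / (12 δ)) ^ k` cycles of length `k`. -/
def FewShortCycles {V : Type*} (G : SimpleGraph V) (d δ : ℕ) (g : ℕ∞) : Prop :=
  ∀ k : ℕ, (k : ℕ∞) < g → ∀ x : V,
    ((G.cyclesThrough x k).ncard : ℝ) ≤ ((d : ℝ) / (12 * (δ : ℝ))) ^ k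

/-- `H` is a spanning subgraph of `G` with girth at least `g` and minimum degree at least `δ`. -/
def IsLargeGirthSpanningSubgraph {V : Type*} (G : SimpleGraph V) (δ : ℕ) (g : ℕ∞)
    (H : SimpleGraph V) : Prop :=
  H ≤ G ∧ g ≤ H.egirth ∧ ∀ v, (δ : ℕ∞) ≤ (H.neighborSet v).encard

end SimpleGraph

/-- The law of independent uniform labels in `[0,1]` at the elements of `V`. -/
noncomputable def iidLabels (V : Type*) : MeasureTheory.Measure (V → unitInterval) :=
  MeasureTheory.Measure.infinitePi fun _ : V =>
    (MeasureTheory.volume : MeasureTheory.Measure unitInterval)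

/-! Put m = ⌊d/δ⌋. Order the neighbours of every vertex by random labels, split the first δm
positions into δ blocks of length m, and let every vertex pick one uniform position in each block,
independently. Keeping every edge that an endpoint picks gives minimum degree at least δ whatever
the choices are; only the short cycles have to be destroyed. A given k-cycle is kept with
probability at most (2/m)^k: there are 2^k ways to assign each edge to an endpoint that picks it,
vertices choose independently, and one vertex picks two given positions with probability at most
m^(-2).

The cycles are destroyed by Moser–Tardos resampling. A table r holds the successive choices of every
vertex, and disjoint bad vertex sets are resampled simultaneously. When S is resampled, running the
history backwards and keeping only what influences S gives a list of layers of disjoint sets, each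
meeting the next later layer, all of them bad for the table entries current at their turn
(`IsResampling.exists_layers`). The sets of a list read disjoint parts of the table, so the list is
explained with probability at most the product of the weights w(S) bounding the probabilities of bad
events (`measure_isExplained_le`). If Σ_{S∋v} w(S)2^|S| ≤ 1 for all v, the lists ending with S have
total weight at most w(S)2^|S| (`tsum_layersWeight_le`), so the expected number of explained lists
around v is at most 1, and almost surely every vertex is resampled finitely often
(`ae_forall_isResampling_eventually_eq`). Here the condition reads Σ_k N_k (4/m)^k ≤ 1 over k < g,
with N_k the number of k-cycles through v; the bound on N_k gives it (`tsum_cycleWeight_le_one`).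

For locality, each round treats sets of one size and resamples those candidates that meet no other
candidate, so the state at time t is determined by a ball (`IsLocalEmbedding.resampleCounter_eq`).
Rounds of each type recur forever and distinct labels isolate any given set in some type of round,
so no bad set survives in the limit (`notMem_bad_of_eventually_eq`). One uniform label per vertex is
decoded into a selection label and a row of the table. The limit of the kept positions is then
Borel, and statement (1) follows because an almost sure event is nonempty. -/

/-! ### Layered families of finite sets and resampling tables -/

section Layers

open Finset

variable {V A : Type*} [DecidableEq V]

/-- The union of a finite family of finite sets. -/
def layerCover (I : Finset (Finset V)) : Finset V := I.biUnion id

theorem mem_layerCover {I : Finset (Finset V)} {v : V} : v ∈ layerCover I ↔ ∃ S ∈ I, v ∈ S := by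
  simp [layerCover]

/-- The number of layers that cover `v`. -/
def layerCount : List (Finset (Finset V)) → V → ℕ
  | [], _ => 0
  | I :: L, v => layerCount L v + if v ∈ layerCover I then 1 else 0

/-- A list of families of pairwise disjoint sets, each of which is nonempty (except possibly for the
first one) and consists of sets meeting the previous family. -/
def IsLayered : List (Finset (Finset V)) → Prop
  | [] => True
  | I :: L => (I : Set (Finset V)).PairwiseDisjoint id ∧ IsLayered L ∧
      ∀ J ∈ L.head?, J.Nonempty ∧ ∀ S ∈ J, ¬ Disjoint S (layerCover I)

/-- The resampling table `r` explains the layers `L`, the last layer being the earliest one: every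
set of every layer is bad for the entries of the table that are current when it is resampled,
if the counters start from `b`. -/
def IsExplained (Bad : Finset V → Set (V → A)) (r : V × ℕ → A) (b : V → ℕ) :
    List (Finset (Finset V)) → Prop
  | [] => True
  | I :: L => IsExplained Bad r b L ∧ ∀ S ∈ I, (fun v => r (v, b v + layerCount L v)) ∈ Bad S

/-- Membership in `Bad S` depends only on the coordinates in `S`. -/
def DependsOnlyOn (Bad : Finset V → Set (V → A)) : Prop :=
  ∀ S s s', (∀ v ∈ S, s v = s' v) → s ∈ Bad S → s' ∈ Bad S

variable {Bad : Finset V → Set (V → A)} {r : V × ℕ → A}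

/-- All vertices covered by some layer. -/
def layersSupport (L : List (Finset (Finset V))) : Finset V :=
  L.foldr (fun I s => layerCover I ∪ s) ∅

@[simp] theorem layersSupport_nil : layersSupport ([] : List (Finset (Finset V))) = ∅ := rfl

@[simp] theorem layersSupport_cons (I : Finset (Finset V)) (L : List (Finset (Finset V))) :
    layersSupport (I :: L) = layerCover I ∪ layersSupport L := rfl

theorem layerCount_eq_zero {L : List (Finset (Finset V))} {v : V} (h : v ∉ layersSupport L) :
    layerCount L v = 0 := by
  induction L with
  | nil => rfl
  | cons I L ih =>
    simp only [layersSupport_cons, mem_union, not_or] at h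
    simp [layerCount, ih h.2, h.1]

theorem IsExplained.congr (hB : DependsOnlyOn Bad) {b b' : V → ℕ} {L : List (Finset (Finset V))}
    (hb : ∀ v ∈ layersSupport L, b v = b' v) (h : IsExplained Bad r b L) :
    IsExplained Bad r b' L := by
  induction L with
  | nil => trivial
  | cons I L ih =>
    refine ⟨ih (fun v hv => hb v (by simp [hv])) h.1, fun S hS => hB S _ _ ?_ (h.2 S hS)⟩
    intro v hv
    rw [hb v (by simp [mem_layerCover]; exact Or.inl ⟨S, hS, hv⟩)]

/-- Inserting one more set as the earliest one, in case it meets some layer. -/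
theorem exists_insert_of_not_disjoint (hB : DependsOnlyOn Bad) {b : V → ℕ} {S : Finset V}
    (hS : (fun v => r (v, b v)) ∈ Bad S) (L : List (Finset (Finset V))) :
    ∀ I : Finset (Finset V), ¬ Disjoint S (layersSupport (I :: L)) → IsLayered (I :: L) →
      IsExplained Bad r (fun v => b v + if v ∈ S then 1 else 0) (I :: L) →
      ∃ L', IsLayered (I :: L') ∧ IsExplained Bad r b (I :: L') ∧
        ∀ v, layerCount (I :: L') v = layerCount (I :: L) v + if v ∈ S then 1 else 0 := by
  have key : ∀ (I : Finset (Finset V)) (L L' : List (Finset (Finset V))),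
      (∀ v, layerCount L' v = layerCount L v + if v ∈ S then 1 else 0) →
      IsExplained Bad r b L' →
      (∀ T ∈ I, (fun v => r (v, (b v + if v ∈ S then 1 else 0) + layerCount L v)) ∈ Bad T) →
      IsExplained Bad r b (I :: L') ∧
        ∀ v, layerCount (I :: L') v = layerCount (I :: L) v + if v ∈ S then 1 else 0 := by
    intro I L L' hc hE hI
    refine ⟨⟨hE, fun T hT => ?_⟩, fun v => ?_⟩
    · convert hI T hT using 4 with v
      rw [hc]; ring
    · simp only [layerCount, hc]; ring
  have shift : ∀ L : List (Finset (Finset V)), Disjoint S (layersSupport L) →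
      IsExplained Bad r (fun v => b v + if v ∈ S then 1 else 0) L → IsExplained Bad r b L := by
    intro L hL h
    refine h.congr hB fun v hv => ?_
    rw [if_neg (Finset.disjoint_right.1 hL hv), add_zero]
  induction L with
  | nil =>
    intro I hd hL hE
    have hd' : ¬ Disjoint S (layerCover I) := by simpa using hd
    -- Nothing precedes `I`, so `S` forms a new earliest layer.
    refine ⟨[{S}], ⟨hL.1, ⟨by simp, trivial, by simp⟩, by simpa using hd'⟩, key I [] [{S}] ?_ ?_ hE.2⟩
    · intro v; simp [layerCount, layerCover]
    · exact ⟨trivial, by simpa [layerCount] using hS⟩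
  | cons J L ih =>
    intro I hd hL hE
    -- `S` belongs just before the earliest layer that it meets. If it misses `J` and everything
    -- earlier, it meets `I` and can join `J`, which stays disjoint; otherwise it is inserted
    -- further down.
    by_cases ht : Disjoint S (layersSupport (J :: L))
    · have hd' : ¬ Disjoint S (layerCover I) := by
        intro h; apply hd
        rw [layersSupport_cons]
        exact Finset.disjoint_union_right.2 ⟨h, ht⟩
      have hJL := Finset.disjoint_union_right.1 (by simpa using ht : Disjoint S (_ ∪ _))
      obtain ⟨hI, ⟨hJ, hL2, hL3⟩, hJI⟩ := hL
      have hJI := hJI J (by simp)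
      have hE' := shift _ ht hE.1
      refine ⟨insert S J :: L, ⟨hI, ⟨?_, hL2, ?_⟩, ?_⟩,
        key I (J :: L) (insert S J :: L) ?_ ⟨hE'.1, ?_⟩ hE.2⟩
      · rw [Finset.coe_insert]
        refine hJ.insert fun T hT _ => ?_
        refine Finset.disjoint_left.2 fun v hv hvT => ?_
        exact Finset.disjoint_left.1 hJL.1 hv (mem_layerCover.2 ⟨T, hT, hvT⟩)
      · intro K hK
        refine ⟨(hL3 K hK).1, fun T hT h => (hL3 K hK).2 T hT (h.mono_right ?_)⟩
        intro v; simp only [mem_layerCover]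
        rintro ⟨U, hU, hv⟩; exact ⟨U, by simp [hU], hv⟩
      · intro K hK
        simp only [List.head?_cons, Option.mem_def, Option.some.injEq] at hK
        subst hK
        refine ⟨by simp, fun T hT => ?_⟩
        rcases Finset.mem_insert.1 hT with rfl | hT
        exacts [hd', hJI.2 T hT]
      · intro v
        have : v ∈ S → ¬ ∃ T ∈ J, v ∈ T := fun hv => by
          rw [← mem_layerCover]; exact Finset.disjoint_left.1 hJL.1 hv
        simp only [layerCount, mem_layerCover, Finset.mem_insert, exists_eq_or_imp]
        by_cases hv : v ∈ S
        · simp [hv, this hv]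
        · simp [hv]
      · intro T hT
        rcases Finset.mem_insert.1 hT with rfl | hT
        · refine hB _ _ _ (fun v hv => ?_) hS
          rw [layerCount_eq_zero (Finset.disjoint_left.1 hJL.2 hv), add_zero]
        · exact hE'.2 T hT
    · obtain ⟨L', h1, h2, h3⟩ := ih J ht hL.2.1 hE.1
      refine ⟨J :: L', ⟨hL.1, h1, ?_⟩, key I (J :: L) (J :: L') h3 h2 hE.2⟩
      intro K hK
      exact hL.2.2 K (by simpa using hK)

/-- Inserting one more set as the earliest one. -/
theorem exists_insert (hB : DependsOnlyOn Bad) {b : V → ℕ} {S : Finset V}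
    (hS : (fun v => r (v, b v)) ∈ Bad S) {I : Finset (Finset V)} {L : List (Finset (Finset V))}
    (hL : IsLayered (I :: L))
    (hE : IsExplained Bad r (fun v => b v + if v ∈ S then 1 else 0) (I :: L)) :
    ∃ L', IsLayered (I :: L') ∧ IsExplained Bad r b (I :: L') ∧
      (∀ v ∈ layerCover I,
        layerCount (I :: L') v = layerCount (I :: L) v + if v ∈ S then 1 else 0) ∧
      layersSupport (I :: L') ⊆ layersSupport (I :: L) ∪ S := by
  have hsupp : ∀ L : List (Finset (Finset V)), ∀ v, v ∈ layersSupport L ↔ layerCount L v ≠ 0 := by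
    intro L v
    induction L with
    | nil => simp [layerCount]
    | cons I L ih => simp [layerCount, ih]; tauto
  -- A set that meets no layer is dropped: it does not change the counters that the list reads.
  by_cases hd : Disjoint S (layersSupport (I :: L))
  · refine ⟨L, hL, hE.congr hB fun v hv => ?_, fun v hv => ?_, subset_union_left⟩
    · rw [if_neg (Finset.disjoint_right.1 hd hv), add_zero]
    · rw [if_neg (Finset.disjoint_right.1 hd (by simp [hv])), add_zero]
  · obtain ⟨L', h1, h2, h3⟩ := exists_insert_of_not_disjoint hB hS L I hd hL hE
    refine ⟨L', h1, h2, fun v _ => h3 v, fun v hv => ?_⟩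
    rw [mem_union, hsupp]
    rw [hsupp, h3] at hv
    by_contra h
    push Not at h
    simp [h] at hv

/-- Inserting a finite family of disjoint sets that are bad at the same time. -/
theorem exists_insert_family (hB : DependsOnlyOn Bad) {b : V → ℕ} {I : Finset (Finset V)}
    (F : Finset (Finset V)) (hF : (F : Set (Finset V)).PairwiseDisjoint id)
    (hbad : ∀ S ∈ F, (fun v => r (v, b v)) ∈ Bad S) :
    ∀ L, IsLayered (I :: L) →
      IsExplained Bad r (fun v => b v + if v ∈ layerCover F then 1 else 0) (I :: L) →
      ∃ L', IsLayered (I :: L') ∧ IsExplained Bad r b (I :: L') ∧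
        (∀ v ∈ layerCover I,
          layerCount (I :: L') v = layerCount (I :: L) v + if v ∈ layerCover F then 1 else 0) := by
  induction F using Finset.induction_on with
  | empty => intro L hL hE; exact ⟨L, hL, by simpa [layerCover] using hE, by simp [layerCover]⟩
  | insert S F hSF ih =>
    intro L hL hE
    rw [Finset.coe_insert] at hF
    have hdis : ∀ v ∈ S, v ∉ layerCover F := by
      intro v hv hvF
      obtain ⟨T, hT, hvT⟩ := mem_layerCover.1 hvF
      have hne : S ≠ T := fun h => hSF (h ▸ hT)
      exact Finset.disjoint_left.1 (hF (Set.mem_insert _ _) (Set.mem_insert_of_mem _ hT) hne) hv hvT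
    have hsplit : ∀ v, (if v ∈ layerCover (insert S F) then 1 else 0)
        = (if v ∈ layerCover F then 1 else 0) + if v ∈ S then 1 else 0 := by
      intro v
      have : v ∈ layerCover (insert S F) ↔ v ∈ S ∨ v ∈ layerCover F := by
        simp [mem_layerCover]
      by_cases h1 : v ∈ S
      · simp [this, h1, hdis v h1]
      · simp [this, h1]
    obtain ⟨L₁, h1, h2, h3, -⟩ := exists_insert hB (S := S)
      (b := fun v => b v + if v ∈ layerCover F then 1 else 0)
      (hB S _ _ (fun v hv => by rw [if_neg (hdis v hv), add_zero]) (hbad S (by simp))) hL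
      (by simpa only [hsplit, add_assoc] using hE)
    obtain ⟨L₂, h4, h5, h6⟩ := ih (hF.subset (Set.subset_insert _ _))
      (fun T hT => hbad T (by simp [hT])) L₁ h1 h2
    refine ⟨L₂, h4, h5, fun v hv => ?_⟩
    rw [h6 v hv, h3 v hv, hsplit]; ring

/-- The counters `c` arise from simultaneously resampling, at every time `t`, the pairwise disjoint
sets in `𝒮 t`, all of which are bad at that time. -/
structure IsResampling (Bad : Finset V → Set (V → A)) (r : V × ℕ → A) (c : ℕ → V → ℕ)
    (𝒮 : ℕ → Set (Finset V)) : Prop where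
  zero : ∀ v, c 0 v = 0
  disjoint : ∀ t, (𝒮 t).PairwiseDisjoint id
  bad : ∀ t, ∀ S ∈ 𝒮 t, (fun v => r (v, c t v)) ∈ Bad S
  succ_of_mem : ∀ t v, (∃ S ∈ 𝒮 t, v ∈ S) → c (t + 1) v = c t v + 1
  succ_of_notMem : ∀ t v, (¬ ∃ S ∈ 𝒮 t, v ∈ S) → c (t + 1) v = c t v

variable {c : ℕ → V → ℕ} {𝒮 : ℕ → Set (Finset V)}

/-- Time runs backwards: the sets resampled at time `t` that meet the current support are inserted
as earliest ones, which turns an explanation from `c (t + 1)` into one from `c t`. At time 0 all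
counters are 0. The latest layer `I` never changes. -/
theorem IsResampling.exists_layers_from (h : IsResampling Bad r c 𝒮) (hB : DependsOnlyOn Bad)
    (I : Finset (Finset V)) (t : ℕ) : ∀ L, IsLayered (I :: L) → IsExplained Bad r (c t) (I :: L) →
      ∃ L', IsLayered (I :: L') ∧ IsExplained Bad r (fun _ => 0) (I :: L') ∧
        ∀ v ∈ layerCover I, layerCount (I :: L') v = layerCount (I :: L) v + c t v := by
  induction t with
  | zero =>
    intro L hL hE
    have : c 0 = fun _ => 0 := funext h.zero
    exact ⟨L, hL, this ▸ hE, by simp [h.zero]⟩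
  | succ t ih =>
    intro L hL hE
    classical
    set U := layersSupport (I :: L) with hU
    -- By disjointness every vertex of the finite set `U` lies in at most one member of `𝒮 t`.
    have hfin : {S ∈ 𝒮 t | ¬ Disjoint S U}.Finite := by
      let F : V → Finset V := fun v => if h : ∃ S ∈ 𝒮 t, v ∈ S then h.choose else ∅
      refine (U.finite_toSet.image F).subset ?_
      rintro S ⟨hS, hSU⟩
      obtain ⟨v, hv, hvU⟩ := Finset.not_disjoint_iff.1 hSU
      refine ⟨v, hvU, ?_⟩
      have hex : ∃ S ∈ 𝒮 t, v ∈ S := ⟨S, hS, hv⟩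
      simp only [F, dif_pos hex]
      by_contra hne
      exact Finset.disjoint_left.1 (h.disjoint t hex.choose_spec.1 hS hne) hex.choose_spec.2 hv
    set F := hfin.toFinset with hF
    have hmem : ∀ S, S ∈ F ↔ S ∈ 𝒮 t ∧ ¬ Disjoint S U := by simp [hF]
    have hcov : ∀ v ∈ U, c (t + 1) v = c t v + if v ∈ layerCover F then 1 else 0 := by
      intro v hv
      by_cases hvF : v ∈ layerCover F
      · obtain ⟨S, hS, hvS⟩ := mem_layerCover.1 hvF
        rw [if_pos hvF, h.succ_of_mem t v ⟨S, ((hmem S).1 hS).1, hvS⟩]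
      · rw [if_neg hvF, h.succ_of_notMem t v, add_zero]
        rintro ⟨S, hS, hvS⟩
        exact hvF (mem_layerCover.2
          ⟨S, (hmem S).2 ⟨hS, Finset.not_disjoint_iff.2 ⟨v, hvS, hv⟩⟩, hvS⟩)
    obtain ⟨L₁, h1, h2, h3⟩ := exists_insert_family (b := c t) hB F
      ((h.disjoint t).subset fun S hS => ((hmem S).1 hS).1)
      (fun S hS => h.bad t S ((hmem S).1 hS).1) L hL (hE.congr hB hcov)
    obtain ⟨L₂, h4, h5, h6⟩ := ih L₁ h1 h2
    refine ⟨L₂, h4, h5, fun v hv => ?_⟩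
    rw [h6 v hv, h3 v hv, hcov v (by simp [hU, hv])]; ring

/-- The number of resamplings of `v` can be read off the list, so unboundedly many resamplings would
need infinitely many explained lists. -/
theorem IsResampling.exists_layers (h : IsResampling Bad r c 𝒮) (hB : DependsOnlyOn Bad) {t : ℕ}
    {S : Finset V} (hS : S ∈ 𝒮 t) : ∃ L, IsLayered ({S} :: L) ∧
      IsExplained Bad r (fun _ => 0) ({S} :: L) ∧
      ∀ v ∈ S, layerCount ({S} :: L) v = c t v + 1 := by
  obtain ⟨L, h1, h2, h3⟩ := h.exists_layers_from hB {S} t [] ⟨by simp, trivial, by simp⟩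
    ⟨trivial, by simpa [layerCount] using h.bad t S hS⟩
  refine ⟨L, h1, h2, fun v hv => ?_⟩
  have hv' : v ∈ layerCover {S} := by simpa [layerCover] using hv
  rw [h3 v hv']; simp [layerCount, hv', add_comm]

/-- If only finitely many layered lists ending with a set around `v` are explained by the table,
then the counter of `v` stabilises. -/
theorem IsResampling.exists_eventually_eq (h : IsResampling Bad r c 𝒮) (hB : DependsOnlyOn Bad)
    (v : V) (hfin : {p : Finset V × List (Finset (Finset V)) | v ∈ p.1 ∧
      IsLayered ({p.1} :: p.2) ∧ IsExplained Bad r (fun _ => 0) ({p.1} :: p.2)}.Finite) :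
    ∃ T, ∀ t ≥ T, c t v = c T v := by
  obtain ⟨B, hBd⟩ := (hfin.image fun p => layerCount ({p.1} :: p.2) v).bddAbove
  have hmono : Monotone fun t => c t v := by
    refine monotone_nat_of_le_succ fun t => ?_
    by_cases hv : ∃ S ∈ 𝒮 t, v ∈ S
    · rw [h.succ_of_mem t v hv]; omega
    · rw [h.succ_of_notMem t v hv]
  have hle : ∀ t, c t v ≤ B := by
    intro t
    induction t with
    | zero => simp [h.zero]
    | succ t ih =>
      by_cases hv : ∃ S ∈ 𝒮 t, v ∈ S
      · obtain ⟨S, hS, hvS⟩ := hv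
        obtain ⟨L, h1, h2, h3⟩ := h.exists_layers hB hS
        rw [h.succ_of_mem t v ⟨S, hS, hvS⟩, ← h3 v hvS]
        exact hBd ⟨(S, L), ⟨hvS, h1, h2⟩, rfl⟩
      · rwa [h.succ_of_notMem t v hv]
  obtain ⟨m, ⟨T, hT⟩, hmax⟩ := Set.Finite.exists_maximal (s := Set.range fun t => c t v)
    ((Set.finite_Iic B).subset (by rintro _ ⟨t, rfl⟩; exact hle t)) ⟨_, 0, rfl⟩
  refine ⟨T, fun t ht => le_antisymm ?_ (hmono ht)⟩
  have := hmax ⟨t, rfl⟩ (hT ▸ hmono ht)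
  exact this.trans hT.ge

end Layers

/-! ### Total weight of the layered lists and almost sure termination -/

section Witness

open Finset MeasureTheory ProbabilityTheory
open scoped ENNReal

variable {V A : Type*} [DecidableEq V]

/-- The sum over all disjoint families meeting `U` of the products of the weights. -/
theorem tsum_disjoint_families_le (μ : Finset V → ℝ≥0∞)
    (hμ : ∀ v, ∑' S : Finset V, (if v ∈ S then μ S else 0) ≤ 1) (U : Finset V) :
    ∑' J : Finset (Finset V), (open Classical in
      if (J : Set (Finset V)).PairwiseDisjoint id ∧ ∀ S ∈ J, ¬ Disjoint S U
        then ∏ S ∈ J, μ S else 0) ≤ 2 ^ #U := by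
  classical
  induction U using Finset.induction_on with
  | empty =>
    rw [tsum_eq_single ∅]
    · simp
    · intro J hJ
      obtain ⟨S, hS⟩ := Finset.nonempty_iff_ne_empty.2 hJ
      rw [if_neg]
      rintro ⟨-, h⟩
      exact h S hS (by simp)
  | insert v U hv ih =>
    set h : Finset (Finset V) → ℝ≥0∞ := fun J =>
      if (J : Set (Finset V)).PairwiseDisjoint id ∧ ∀ S ∈ J, ¬ Disjoint S U
        then ∏ S ∈ J, μ S else 0 with hh
    -- At most one member of `J` contains `v`. Once it is removed, all the others must meet `U`;
    -- hence adding `v` to `U` multiplies the bound by at most 1 + 1.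
    have hpt : ∀ J : Finset (Finset V),
        (if (J : Set (Finset V)).PairwiseDisjoint id ∧ ∀ S ∈ J, ¬ Disjoint S (insert v U)
          then ∏ S ∈ J, μ S else 0) ≤
        h J + ∑' S, (if v ∈ S then μ S else 0) * (if S ∈ J then h (J.erase S) else 0) := by
      intro J
      split_ifs with hJ
      swap; · exact zero_le
      by_cases hex : ∃ S ∈ J, v ∈ S
      · obtain ⟨S, hS, hvS⟩ := hex
        refine le_trans ?_ le_add_self
        refine le_trans ?_ (ENNReal.le_tsum S)
        rw [if_pos hvS, if_pos hS, ← Finset.mul_prod_erase _ _ hS, hh]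
        simp only
        rw [if_pos]
        refine ⟨hJ.1.subset (by simp), fun T hT => ?_⟩
        rw [Finset.mem_erase] at hT
        have := hJ.2 T hT.2
        rw [Finset.disjoint_insert_right] at this
        intro hTU
        refine this ⟨fun hvT => ?_, hTU⟩
        exact Finset.disjoint_left.1 (hJ.1 hT.2 hS hT.1) hvT hvS
      · refine le_trans (le_of_eq ?_) le_self_add
        rw [hh]; simp only
        rw [if_pos]
        refine ⟨hJ.1, fun T hT hTU => hJ.2 T hT ?_⟩
        exact Finset.disjoint_insert_right.2 ⟨fun hvT => hex ⟨T, hT, hvT⟩, hTU⟩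
    have herase : ∀ S, ∑' J : Finset (Finset V), (if S ∈ J then h (J.erase S) else 0) ≤
        ∑' J, h J := by
      intro S
      rw [← tsum_subtype_eq_of_support_subset (s := {J : Finset (Finset V) | S ∈ J})]
      · have hinj : Function.Injective
            fun J : {J : Finset (Finset V) | S ∈ J} => J.1.erase S := by
          intro J J' e
          exact Subtype.ext (by
            rw [← Finset.insert_erase J.2, ← Finset.insert_erase J'.2]; exact congrArg _ e)
        refine le_trans (le_of_eq ?_) (ENNReal.tsum_comp_le_tsum_of_injective hinj h)
        exact tsum_congr fun J => if_pos J.2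
      · intro J hJ
        by_contra hn
        exact hJ (if_neg hn)
    calc _ ≤ ∑' J, (h J + ∑' S, (if v ∈ S then μ S else 0) *
            (if S ∈ J then h (J.erase S) else 0)) := ENNReal.tsum_le_tsum hpt
      _ = ∑' J, h J + ∑' S, (if v ∈ S then μ S else 0) *
            ∑' J : Finset (Finset V), (if S ∈ J then h (J.erase S) else 0) := by
          rw [ENNReal.tsum_add, ENNReal.tsum_comm]
          simp_rw [ENNReal.tsum_mul_left]
      _ ≤ ∑' J, h J + ∑' S, (if v ∈ S then μ S else 0) * ∑' J, h J := by
          exact add_le_add le_rfl (ENNReal.tsum_le_tsum fun S => mul_le_mul_right (herase S) _)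
      _ = ∑' J, h J + (∑' S, (if v ∈ S then μ S else 0)) * ∑' J, h J := by
          rw [ENNReal.tsum_mul_right]
      _ ≤ 2 ^ #U + 1 * 2 ^ #U := by gcongr; exact hμ v
      _ = 2 ^ #(insert v U) := by rw [Finset.card_insert_of_notMem hv, pow_succ]; ring

/-- The product of the weights of all sets of all layers. -/
noncomputable def layersWeight (w : Finset V → ℝ≥0∞) : List (Finset (Finset V)) → ℝ≥0∞
  | [] => 1
  | I :: L => (∏ S ∈ I, w S) * layersWeight w L

theorem tsum_list_eq {α : Type*} (f : List α → ℝ≥0∞) :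
    ∑' L, f L = f [] + ∑' a, ∑' L, f (a :: L) := by
  classical
  rw [ENNReal.tsum_eq_add_tsum_ite [], ← ENNReal.tsum_prod]
  congr 1
  have hinj : Function.Injective fun p : α × List α => p.1 :: p.2 := by
    rintro ⟨a, L⟩ ⟨b, M⟩ h
    simpa using h
  rw [← hinj.tsum_eq]
  · simp
  · rintro L hL
    cases L with
    | nil => simp at hL
    | cons a L => exact ⟨(a, L), rfl⟩

/-- By induction the lists continuing with the layer `J` contribute at most the weights w(S)2^|S| of
`J`. Summing over the families `J` that meet `I` gives 2^|layerCover I|, which is exactly the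
product of the factors 2^|S| over `I`. -/
theorem tsum_layersWeight_le (w : Finset V → ℝ≥0∞)
    (hw : ∀ v, ∑' S : Finset V, (if v ∈ S then w S * 2 ^ #S else 0) ≤ 1)
    (I : Finset (Finset V)) :
    ∑' L, (open Classical in if IsLayered (I :: L) then layersWeight w (I :: L) else 0) ≤
      ∏ S ∈ I, (w S * 2 ^ #S) := by
  classical
  -- The induction is on a bound for the length; the full sum is the supremum of its finite subsums.
  have hlen : ∀ n : ℕ, ∀ I : Finset (Finset V), ∑' L : List (Finset (Finset V)),
      (if L.length ≤ n then if IsLayered (I :: L) then layersWeight w (I :: L) else 0 else 0) ≤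
      ∏ S ∈ I, (w S * 2 ^ #S) := by
    intro n
    induction n with
    | zero =>
      intro I
      rw [tsum_eq_single []]
      · simp only [List.length_nil, le_refl, if_true]
        split_ifs
        · simp only [layersWeight, mul_one]
          refine Finset.prod_le_prod' fun S _ => ?_
          exact le_mul_of_one_le_right' (one_le_pow₀ (by norm_num))
        · exact zero_le
      · intro L hL
        rw [if_neg]
        simpa using hL
    | succ n ih =>
      intro I
      by_cases hI : (I : Set (Finset V)).PairwiseDisjoint id
      swap
      · refine le_trans (le_of_eq ?_) zero_le
        rw [ENNReal.tsum_eq_zero]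
        intro L
        rw [if_neg (c := IsLayered (I :: L)) (fun h => hI h.1)]
        simp
      rw [tsum_list_eq]
      set g : Finset (Finset V) → ℝ≥0∞ := fun J =>
        if (J : Set (Finset V)).PairwiseDisjoint id ∧ ∀ S ∈ J, ¬ Disjoint S (layerCover I)
        then ∏ S ∈ J, (w S * 2 ^ #S) else 0 with hg
      have hcons : ∀ J : Finset (Finset V), ∑' L : List (Finset (Finset V)),
          (if (J :: L).length ≤ n + 1 then
            if IsLayered (I :: J :: L) then layersWeight w (I :: J :: L) else 0 else 0) ≤
          if J = ∅ then 0 else (∏ S ∈ I, w S) * g J := by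
        intro J
        by_cases hJ : (J : Set (Finset V)).PairwiseDisjoint id ∧
          (∀ S ∈ J, ¬ Disjoint S (layerCover I)) ∧ J ≠ ∅
        · rw [if_neg hJ.2.2, hg]
          simp only
          rw [if_pos ⟨hJ.1, hJ.2.1⟩]
          refine le_trans ?_ (mul_le_mul_right (ih J) _)
          rw [← ENNReal.tsum_mul_left]
          refine ENNReal.tsum_le_tsum fun L => ?_
          simp only [List.length_cons, add_le_add_iff_right]
          split_ifs with h1 h2 h3
          · rfl
          · exact absurd h2.2.1 h3
          all_goals simp
        · refine le_trans (le_of_eq ?_) zero_le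
          rw [ENNReal.tsum_eq_zero]
          intro L
          rw [if_neg (c := IsLayered _), ite_self]
          intro h
          have := h.2.2 J (by simp)
          exact hJ ⟨h.2.1.1, this.2, this.1.ne_empty⟩
      -- The list that stops at `I` takes the place of the empty family `J`, as later entries of a
      -- layered list are nonempty.
      have hnil : (if ([] : List (Finset (Finset V))).length ≤ n + 1 then
          if IsLayered [I] then layersWeight w [I] else 0 else 0) ≤ (∏ S ∈ I, w S) * g ∅ := by
        simp only [hg]
        simp [layersWeight]
        split_ifs <;> simp
      calc _ ≤ (∏ S ∈ I, w S) * g ∅ + ∑' J, (if J = ∅ then 0 else (∏ S ∈ I, w S) * g J) :=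
            add_le_add hnil (ENNReal.tsum_le_tsum hcons)
        _ = ∑' J, (∏ S ∈ I, w S) * g J :=
            by
            rw [ENNReal.tsum_eq_add_tsum_ite (f := fun J => (∏ S ∈ I, w S) * g J) ∅]
            congr! 2
            funext J
            congr
        _ = (∏ S ∈ I, w S) * ∑' J, g J := ENNReal.tsum_mul_left
        _ ≤ (∏ S ∈ I, w S) * 2 ^ #(layerCover I) := by
            gcongr; exact tsum_disjoint_families_le _ hw _
        _ = ∏ S ∈ I, (w S * 2 ^ #S) := by
            rw [Finset.prod_mul_distrib, Finset.prod_pow_eq_pow_sum, layerCover,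
              Finset.card_biUnion hI]
            rfl
  rw [ENNReal.tsum_eq_iSup_sum]
  refine iSup_le fun s => ?_
  refine le_trans ?_ (hlen (s.sup List.length) I)
  refine le_trans (le_of_eq ?_) (ENNReal.sum_le_tsum s)
  refine Finset.sum_congr rfl fun L hL => ?_
  rw [if_pos (c := L.length ≤ _) (Finset.le_sup (f := List.length) hL)]

variable [MeasurableSpace A]

theorem measure_inter_eq_mul_of_disjoint {ι : Type*} (ν : Measure A) [IsProbabilityMeasure ν]
    {E F : Set (ι → A)} (hE : MeasurableSet E) (hF : MeasurableSet F) {s t : Finset ι}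
    (hst : Disjoint s t) (hEs : DependsOn (· ∈ E) s) (hFt : DependsOn (· ∈ F) t) :
    Measure.infinitePi (fun _ : ι => ν) (E ∩ F) =
      Measure.infinitePi (fun _ : ι => ν) E * Measure.infinitePi (fun _ : ι => ν) F := by
  classical
  have hA : Nonempty A := by
    by_contra h
    rw [not_nonempty_iff] at h
    have := measure_univ (μ := ν)
    rw [Set.eq_empty_of_isEmpty (Set.univ : Set A)] at this
    simp at this
  obtain ⟨a₀⟩ := hA
  have hind := (iIndepFun_infinitePi (P := fun _ : ι => ν) (X := fun _ a => a)
    (fun _ => measurable_id)).indepFun_finset s t hst (fun i => measurable_pi_apply i)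
  have ext : ∀ u : Finset ι, Measurable fun (x : u → A) (i : ι) =>
      if h : i ∈ u then x ⟨i, h⟩ else a₀ := by
    intro u
    refine measurable_pi_lambda _ fun i => ?_
    by_cases h : i ∈ u
    · simp only [h, dif_pos]; exact measurable_pi_apply _
    · simp only [h, dif_neg, not_false_eq_true]; exact measurable_const
  have hpre : ∀ (u : Finset ι) (D : Set (ι → A)), DependsOn (· ∈ D) u →
      D = (fun x (i : u) => x i) ⁻¹' ((fun (x : u → A) (i : ι) =>
        if h : i ∈ u then x ⟨i, h⟩ else a₀) ⁻¹' D) := by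
    intro u D hD
    ext x
    refine iff_of_eq (hD fun i hi => ?_)
    have hi' : i ∈ u := by simpa using hi
    simp [hi']
  have := hind.measure_inter_preimage_eq_mul _ _ ((ext s) hE) ((ext t) hF)
  rw [← hpre s E hEs, ← hpre t F hFt] at this
  exact this

variable {Bad : Finset V → Set (V → A)}

theorem measurableSet_isExplained (hm : ∀ S, MeasurableSet (Bad S)) (b : V → ℕ)
    (L : List (Finset (Finset V))) : MeasurableSet {r | IsExplained Bad r b L} := by
  induction L with
  | nil => exact MeasurableSet.univ
  | cons I L ih =>
    have : {r | IsExplained Bad r b (I :: L)} = {r | IsExplained Bad r b L} ∩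
        ⋂ S ∈ I, (fun r : V × ℕ → A => fun v => r (v, b v + layerCount L v)) ⁻¹' Bad S := by
      ext r; simp [IsExplained]
    rw [this]
    refine ih.inter (Finset.measurableSet_biInter _ fun S _ => ?_)
    exact (measurable_pi_lambda _ fun v => measurable_pi_apply _) (hm S)

/-- Each set reads the entries of its vertices at their current counters. Sets of one layer are
disjoint, and a later layer reads larger indices at the vertices covered before, so all these events
are independent. -/
theorem measure_isExplained_le (ν : Measure A) [IsProbabilityMeasure ν]
    (hm : ∀ S, MeasurableSet (Bad S)) (hB : DependsOnlyOn Bad) (w : Finset V → ℝ≥0∞)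
    (hw : ∀ S, Measure.infinitePi (fun _ : V => ν) (Bad S) ≤ w S) (b : V → ℕ)
    (L : List (Finset (Finset V))) (hL : IsLayered L) :
    Measure.infinitePi (fun _ : V × ℕ => ν) {r | IsExplained Bad r b L} ≤ layersWeight w L := by
  -- The induction also records that only finitely many entries are read, all with indices below the
  -- current counters.
  suffices h : Measure.infinitePi (fun _ : V × ℕ => ν) {r | IsExplained Bad r b L} ≤
      layersWeight w L ∧ ∃ T : Finset (V × ℕ), (∀ p ∈ T, p.2 < b p.1 + layerCount L p.1) ∧
        DependsOn (· ∈ {r | IsExplained Bad r b L}) T from h.1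
  induction L with
  | nil =>
    refine ⟨?_, ∅, by simp, fun r r' _ => rfl⟩
    exact prob_le_one
  | cons I L ih =>
    obtain ⟨h1, T, hT, hdep⟩ := ih hL.2.1
    set E := {r | IsExplained Bad r b L} with hE
    set B : Finset V → Set (V × ℕ → A) := fun S =>
      (fun r : V × ℕ → A => fun v => r (v, b v + layerCount L v)) ⁻¹' Bad S with hBdef
    have hBm : ∀ S, MeasurableSet (B S) := fun S =>
      (measurable_pi_lambda _ fun v => measurable_pi_apply _) (hm S)
    have hBμ : ∀ S, Measure.infinitePi (fun _ : V × ℕ => ν) (B S) ≤ w S := by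
      intro S
      have hinj : Function.Injective fun v : V => (v, b v + layerCount L v) := by
        intro v v' h; simpa using congrArg Prod.fst h
      have := Measure.map_infinitePi_infinitePi_of_inj (P := fun _ : V × ℕ => ν) hinj
      rw [hBdef]
      simp only
      rw [← Measure.map_apply (by fun_prop) (hm S), this]
      exact hw S
    let K : Finset V → Finset (V × ℕ) := fun S => S.image fun v => (v, b v + layerCount L v)
    have hBdep : ∀ S, DependsOn (· ∈ B S) (K S) := by
      intro S r r' h
      refine propext ⟨hB S _ _ fun v hv => ?_, hB S _ _ fun v hv => ?_⟩
      · exact h _ (by simp [K]; exact hv)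
      · exact (h _ (by simp [K]; exact hv)).symm
    have claim : ∀ F ⊆ I, Measure.infinitePi (fun _ : V × ℕ => ν) (E ∩ ⋂ S ∈ F, B S) ≤
        (∏ S ∈ F, w S) * layersWeight w L ∧
        DependsOn (· ∈ E ∩ ⋂ S ∈ F, B S) ((T ∪ F.biUnion K : Finset (V × ℕ)) : Set (V × ℕ)) := by
      intro F
      induction F using Finset.induction_on with
      | empty => intro _; simpa using ⟨h1, hdep⟩
      | insert S F hSF ihF =>
        intro hFI
        obtain ⟨hμ, hd⟩ := ihF ((Finset.subset_insert _ _).trans hFI)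
        have hset : (E ∩ ⋂ U ∈ insert S F, B U) = B S ∩ (E ∩ ⋂ U ∈ F, B U) := by
          ext r; simp; tauto
        rw [hset]
        constructor
        · rw [measure_inter_eq_mul_of_disjoint ν (hBm S) ?_ ?_ (hBdep S) hd,
            Finset.prod_insert hSF, mul_assoc]
          · exact mul_le_mul' (hBμ S) hμ
          · exact (measurableSet_isExplained hm b L).inter
              (Finset.measurableSet_biInter _ fun S _ => hBm S)
          · rw [Finset.disjoint_left]
            rintro p hp hp'
            obtain ⟨v, hv, rfl⟩ := Finset.mem_image.1 hp
            rcases Finset.mem_union.1 hp' with hp' | hp'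
            · exact lt_irrefl _ (hT _ hp')
            · obtain ⟨U, hU, hvU⟩ := Finset.mem_biUnion.1 hp'
              obtain ⟨v', hv', he⟩ := Finset.mem_image.1 hvU
              obtain rfl : v' = v := by simpa using congrArg Prod.fst he
              have hne : S ≠ U := fun h => hSF (h ▸ hU)
              exact Finset.disjoint_left.1 (hL.1 (hFI (by simp)) (hFI (by simp [hU])) hne) hv hv'
        · intro r r' h
          have e1 := hBdep S (x := r) (y := r') (fun i hi => h i (by
            rw [Finset.biUnion_insert]; simp at hi ⊢; tauto))
          have e2 := hd (x := r) (y := r') (fun i hi => h i (by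
            rw [Finset.biUnion_insert]; simp at hi ⊢; tauto))
          simp only [Set.mem_inter_iff] at e1 e2 ⊢
          rw [e1, e2]
    have hset : {r | IsExplained Bad r b (I :: L)} = E ∩ ⋂ S ∈ I, B S := by
      ext r; simp [IsExplained, hE, hBdef]
    rw [hset]
    refine ⟨(claim I subset_rfl).1, _, ?_, (claim I subset_rfl).2⟩
    intro p hp
    rcases Finset.mem_union.1 hp with hp | hp
    · exact (hT p hp).trans_le (by simp [layerCount])
    · obtain ⟨S, hS, hpS⟩ := Finset.mem_biUnion.1 hp
      obtain ⟨v, hv, rfl⟩ := Finset.mem_image.1 hpS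
      have : v ∈ layerCover I := mem_layerCover.2 ⟨S, hS, hv⟩
      simp [layerCount, this]

/-- Almost surely, every process that resamples disjoint families of bad sets resamples every
vertex only finitely many times. -/
theorem ae_forall_isResampling_eventually_eq [Countable V] (ν : Measure A)
    [IsProbabilityMeasure ν] (hm : ∀ S, MeasurableSet (Bad S)) (hB : DependsOnlyOn Bad)
    (w : Finset V → ℝ≥0∞) (hw : ∀ S, Measure.infinitePi (fun _ : V => ν) (Bad S) ≤ w S)
    (hsum : ∀ v, ∑' S : Finset V, (if v ∈ S then w S * 2 ^ #S else 0) ≤ 1) :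
    ∀ᵐ r ∂(Measure.infinitePi fun _ : V × ℕ => ν), ∀ c 𝒮, IsResampling Bad r c 𝒮 →
      ∀ v, ∃ T, ∀ t ≥ T, c t v = c T v := by
  classical
  have key : ∀ v : V, ∀ᵐ r ∂(Measure.infinitePi fun _ : V × ℕ => ν),
      {p : Finset V × List (Finset (Finset V)) | r ∈ {r | v ∈ p.1 ∧
        IsLayered ({p.1} :: p.2) ∧ IsExplained Bad r (fun _ => 0) ({p.1} :: p.2)}}.Finite := by
    intro v
    refine ae_finite_setOfPred_mem (ne_top_of_le_ne_top ENNReal.one_ne_top ?_)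
    calc _ ≤ ∑' p : Finset V × List (Finset (Finset V)), (if v ∈ p.1 then
          (if IsLayered ({p.1} :: p.2) then layersWeight w ({p.1} :: p.2) else 0) else 0) := by
          refine ENNReal.tsum_le_tsum fun p => ?_
          by_cases h1 : v ∈ p.1
          · by_cases h2 : IsLayered ({p.1} :: p.2)
            · simpa [h1, h2] using measure_isExplained_le ν hm hB w hw (fun _ => 0) _ h2
            · simp [h2]
          · simp [h1]
      _ = ∑' S : Finset V, (if v ∈ S then ∑' L : List (Finset (Finset V)),
          (if IsLayered ({S} :: L) then layersWeight w ({S} :: L) else 0) else 0) := by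
          rw [ENNReal.tsum_prod (f := fun (S : Finset V) (L : List (Finset (Finset V))) =>
            if v ∈ S then (if IsLayered ({S} :: L) then layersWeight w ({S} :: L) else 0) else 0)]
          refine tsum_congr fun S => ?_
          split_ifs <;> simp
      _ ≤ ∑' S : Finset V, (if v ∈ S then w S * 2 ^ #S else 0) := by
          refine ENNReal.tsum_le_tsum fun S => ?_
          split_ifs
          · simpa using tsum_layersWeight_le w hsum {S}
          · exact le_rfl
      _ ≤ 1 := hsum v
  filter_upwards [ae_all_iff.2 key] with r hr c 𝒮 h v
  exact h.exists_eventually_eq hB v (hr v)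

end Witness

/-! ### A local resampling schedule -/

section Resampling

open Finset

variable {V A : Type*}

/-- An enumeration in which every triple `(k, n, W)` appears infinitely often. -/
def resamplingSchedule (t : ℕ) : ℕ × ℕ × Finset ℕ :=
  ((Encodable.decode t.unpair.1 : Option (ℕ × ℕ × Finset ℕ))).getD (0, 0, ∅)

theorem exists_resamplingSchedule_eq (q : ℕ × ℕ × Finset ℕ) (T : ℕ) :
    ∃ t ≥ T, resamplingSchedule t = q :=
  ⟨Nat.pair (Encodable.encode q) T, Nat.right_le_pair _ _, by simp [resamplingSchedule]⟩

/-- The members of the family `B` that are considered in the rounds of type `q = (k, n, W)`: those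
with `k` elements, at all of which the label is in `[j / n, (j + 1) / n)` for some `j ∈ W`. -/
def IsActive (q : ℕ × ℕ × Finset ℕ) (a : V → unitInterval) (B : Set (Finset V)) (S : Finset V) :
    Prop :=
  S ∈ B ∧ #S = q.1 ∧ ∀ v ∈ S, ⌊(a v : ℝ) * q.2.1⌋₊ ∈ q.2.2

/-- The active sets that meet no other active set. -/
def IsSelected (q : ℕ × ℕ × Finset ℕ) (a : V → unitInterval) (B : Set (Finset V)) (S : Finset V) :
    Prop :=
  IsActive q a B S ∧ ∀ S', IsActive q a B S' → S' ≠ S → Disjoint S' S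

open Classical in
/-- The number of times that the vertices have been resampled before time `t`, if at every time the
selected sets among the bad ones are resampled. -/
noncomputable def resampleCounter (Bad : Finset V → Set (V → A)) (a : V → unitInterval)
    (r : V × ℕ → A) : ℕ → V → ℕ
  | 0, _ => 0
  | t + 1, v => resampleCounter Bad a r t v +
      if ∃ S, IsSelected (resamplingSchedule t) a
        {S | (fun w => r (w, resampleCounter Bad a r t w)) ∈ Bad S} S ∧ v ∈ S then 1 else 0

variable {Bad : Finset V → Set (V → A)} {a : V → unitInterval} {r : V × ℕ → A}

theorem isResampling_resampleCounter : IsResampling Bad r (resampleCounter Bad a r)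
    fun t => {S | IsSelected (resamplingSchedule t) a
        {S | (fun w => r (w, resampleCounter Bad a r t w)) ∈ Bad S} S} where
  zero _ := rfl
  disjoint t S hS S' hS' hne := hS'.2 S hS.1 hne
  bad t S hS := hS.1.1
  succ_of_mem t v h := by simp only [resampleCounter]; rw [if_pos]; exact h
  succ_of_notMem t v h := by simp only [resampleCounter]; rw [if_neg, add_zero]; exact h

/-- For large `n` the cells of width 1/n are shorter than every gap between the finitely many
points. -/
theorem exists_floor_injOn {F : Set unitInterval} (hF : F.Finite) :
    ∃ n : ℕ, Set.InjOn (fun x : unitInterval => ⌊(x : ℝ) * n⌋₊) F := by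
  have key : ∀ x ∈ F, ∀ y ∈ F, ∀ᶠ n : ℕ in Filter.atTop, x ≠ y →
      ⌊(x : ℝ) * n⌋₊ ≠ ⌊(y : ℝ) * n⌋₊ := by
    intro x _ y _
    by_cases hxy : x = y
    · simp [hxy]
    have hpos : 0 < |(x : ℝ) - y| := abs_pos.2 (sub_ne_zero.2 fun h => hxy (Subtype.ext h))
    obtain ⟨N, hN⟩ := exists_nat_gt (1 / |(x : ℝ) - y|)
    filter_upwards [Filter.eventually_ge_atTop N] with n hn _ he
    have h1 : 1 < |(x : ℝ) - y| * n := by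
      rw [div_lt_iff₀ hpos] at hN
      have : (N : ℝ) ≤ n := by exact_mod_cast hn
      nlinarith
    have hx0 : 0 ≤ (x : ℝ) * n := mul_nonneg x.2.1 (Nat.cast_nonneg n)
    have hy0 : 0 ≤ (y : ℝ) * n := mul_nonneg y.2.1 (Nat.cast_nonneg n)
    have h2 := Nat.floor_le hx0
    have h3 := Nat.lt_floor_add_one ((x : ℝ) * n)
    have h4 := Nat.floor_le hy0
    have h5 := Nat.lt_floor_add_one ((y : ℝ) * n)
    rw [he] at h2 h3
    have h6 : |(x : ℝ) - y| * n = |(x : ℝ) * n - y * n| := by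
      rw [← sub_mul, abs_mul, Nat.abs_cast]
    rw [h6] at h1
    have : |(x : ℝ) * n - y * n| < 1 := by rw [abs_lt]; constructor <;> linarith
    linarith
  have := (Filter.eventually_all_finite hF).2 fun x hx =>
    (Filter.eventually_all_finite hF).2 fun y hy => key x hx y hy
  obtain ⟨n, hn⟩ := this.exists
  exact ⟨n, fun x hx y hy he => by_contra fun hne => hn x hx y hy hne he⟩

/-- If the counters stabilise, then nothing is bad for the final entries of the table. -/
theorem notMem_bad_of_eventually_eq (hB : DependsOnlyOn Bad) (ha : Function.Injective a)
    (hfin : ∀ v k, {S : Finset V | v ∈ S ∧ #S = k ∧ (Bad S).Nonempty}.Finite)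
    {c : V → ℕ} (hc : ∀ v, ∃ T, ∀ t ≥ T, resampleCounter Bad a r t v = c v)
    {S : Finset V} (hne : S.Nonempty) : (fun v => r (v, c v)) ∉ Bad S := by
  classical
  intro hS
  choose T hT using hc
  have hN : {S' : Finset V | ¬ Disjoint S' S ∧ #S' = #S ∧ (Bad S').Nonempty}.Finite := by
    refine (S.finite_toSet.biUnion fun v _ => hfin v #S).subset ?_
    rintro S' ⟨h1, h2⟩
    obtain ⟨v, hv, hvS⟩ := Finset.not_disjoint_iff.1 h1
    exact Set.mem_biUnion hvS ⟨hv, h2⟩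
  have hF : (⋃ S' ∈ {S' : Finset V | ¬ Disjoint S' S ∧ #S' = #S ∧ (Bad S').Nonempty},
      (S' : Set V)).Finite := hN.biUnion fun S' _ => S'.finite_toSet
  -- The cells separate the labels of `S` and of all sets that could compete with it in a round of
  -- size `#S`.
  obtain ⟨n, hn⟩ := exists_floor_injOn ((hF.union S.finite_toSet).image a)
  set W : Finset ℕ := S.image fun v => ⌊(a v : ℝ) * n⌋₊ with hW
  obtain ⟨t, ht, hq⟩ := exists_resamplingSchedule_eq (#S, n, W) (S.sup T)
  have hcur : ∀ v ∈ S, ∀ t' ≥ t, resampleCounter Bad a r t' v = c v := fun v hv t' ht' =>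
    hT v t' ((Finset.le_sup hv).trans (ht.trans ht'))
  have hact : IsActive (resamplingSchedule t) a
      {S | (fun w => r (w, resampleCounter Bad a r t w)) ∈ Bad S} S := by
    rw [hq]
    refine ⟨hB S _ _ (fun v hv => ?_) hS, rfl, fun v hv => Finset.mem_image_of_mem _ hv⟩
    rw [hcur v hv t le_rfl]
  have hsel : IsSelected (resamplingSchedule t) a
      {S | (fun w => r (w, resampleCounter Bad a r t w)) ∈ Bad S} S := by
    refine ⟨hact, fun S' hS' hne => ?_⟩
    by_contra hdis
    rw [hq] at hS'
    -- A competitor only has labels in the cells of `S`, so it is contained in `S`, and the sizes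
    -- agree.
    refine hne (Finset.eq_of_subset_of_card_le (fun v hv => ?_) hS'.2.1.ge)
    obtain ⟨w, hw, hwe⟩ := Finset.mem_image.1 (hS'.2.2 v hv)
    have hv' : a v ∈ a '' ((⋃ S' ∈ {S' : Finset V | ¬ Disjoint S' S ∧ #S' = #S ∧
        (Bad S').Nonempty}, (S' : Set V)) ∪ S) :=
      ⟨v, Or.inl (Set.mem_biUnion (x := S') ⟨hdis, hS'.2.1, _, hS'.1⟩ hv), rfl⟩
    have hw' : a w ∈ a '' ((⋃ S' ∈ {S' : Finset V | ¬ Disjoint S' S ∧ #S' = #S ∧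
        (Bad S').Nonempty}, (S' : Set V)) ∪ S) := ⟨w, Or.inr hw, rfl⟩
    rw [← ha (hn hw' hv' hwe)]
    exact hw
  obtain ⟨v, hv⟩ := hne
  have h1 := (isResampling_resampleCounter (Bad := Bad) (a := a) (r := r)).succ_of_mem t v
    ⟨S, hsel, hv⟩
  rw [hcur v hv t le_rfl, hcur v hv (t + 1) (by omega)] at h1
  omega

end Resampling

/-! ### Cycles given by their vertex sets -/

namespace SimpleGraph

open Finset MeasureTheory ProbabilityTheory
open scoped ENNReal

section Cycles

variable {V A : Type*}

/-- The set `S` is the vertex set of a cycle of `H`. -/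
def HasCycleOn (H : SimpleGraph V) (S : Finset V) : Prop :=
  3 ≤ #S ∧ ∃ u : ℕ → V, (∀ i, H.Adj (u i) (u (i + 1))) ∧ (∀ i, u (i + #S) = u i) ∧
    (S : Set V) = Set.range u

theorem exists_walk_of_forall_adj {H : SimpleGraph V} {u : ℕ → V}
    (h : ∀ i, H.Adj (u i) (u (i + 1))) (n : ℕ) :
    ∃ p : H.Walk (u 0) (u n), p.support = (List.range (n + 1)).map u := by
  induction n with
  | zero => exact ⟨.nil, by simp⟩
  | succ n ih =>
    obtain ⟨p, hp⟩ := ih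
    refine ⟨p.concat (h n), ?_⟩
    rw [Walk.support_concat, hp, List.range_succ (n := n + 1), List.map_append]
    simp

theorem range_eq_image_range_of_periodic {u : ℕ → V} {k : ℕ} (hk : 0 < k)
    (h : ∀ i, u (i + k) = u i) : Set.range u = u '' Set.Iio k := by
  have hmod : ∀ i, u (i % k) = u i := Function.Periodic.map_mod_nat h
  ext x
  constructor
  · rintro ⟨i, rfl⟩
    exact ⟨i % k, Nat.mod_lt _ hk, hmod i⟩
  · rintro ⟨i, -, rfl⟩
    exact ⟨i, rfl⟩

/-- A sequence with period `#S` that takes all `#S` values is injective on a period, so it traverses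
a cycle, which can be rotated to start at `v`. -/
theorem HasCycleOn.exists_mem_cyclesThrough {G H : SimpleGraph V} (hHG : H ≤ G) {S : Finset V}
    (h : H.HasCycleOn S) {v : V} (hv : v ∈ S) :
    ∃ C ∈ G.cyclesThrough v #S, C.verts = S ∧ ∀ x y, C.Adj x y → H.Adj x y := by
  classical
  obtain ⟨hk, u, hadj, hper, hrange⟩ := h
  have himg : (Finset.range #S).image u = S := by
    rw [← Finset.coe_inj, hrange, range_eq_image_range_of_periodic (by omega) hper]
    simp
  have hinj : Set.InjOn u (Finset.range #S) := by
    rw [← Finset.card_image_iff, himg, Finset.card_range]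
  obtain ⟨p, hp⟩ := exists_walk_of_forall_adj hadj #S
  have hlen : p.length = #S := by
    have := congrArg List.length hp
    simpa using this
  have h0 : u #S = u 0 := by simpa using hper 0
  let q : H.Walk (u 0) (u 0) := p.copy rfl h0
  have hqs : q.support = (List.range (#S + 1)).map u := by simp [q, hp]
  have hqlen : q.length = #S := by simp [q, hlen]
  have hq : q.IsCycle := by
    have hnil : ¬ q.Nil := by rw [← Walk.length_eq_zero_iff]; omega
    rw [Walk.isCycle_iff_isPath_tail_and_le_length]
    refine ⟨?_, by omega⟩
    rw [Walk.isPath_def, Walk.support_tail_of_not_nil _ hnil, hqs, List.range_succ_eq_map]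
    simp only [List.map_cons, List.tail_cons, List.map_map]
    rw [List.nodup_map_iff_inj_on List.nodup_range]
    intro i hi j hj hij
    rw [List.mem_range] at hi hj
    simp only [Function.comp_apply, Nat.succ_eq_add_one] at hij
    have hred : ∀ i < #S, ∃ i' < #S, u (i + 1) = u i' ∧ (i' = i + 1 ∨ i' = 0 ∧ i + 1 = #S) := by
      intro i hi
      rcases Nat.lt_or_ge (i + 1) #S with h | h
      · exact ⟨i + 1, h, rfl, Or.inl rfl⟩
      · have : i + 1 = #S := by omega
        exact ⟨0, by omega, by rw [this, h0], Or.inr ⟨rfl, this⟩⟩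
    obtain ⟨i', h1, h2, h3⟩ := hred i hi
    obtain ⟨j', h4, h5, h6⟩ := hred j hj
    have := hinj (by simpa using h1) (by simpa using h4) (by rw [← h2, ← h5, hij])
    omega
  have hmem : ∀ x, x ∈ q.support ↔ x ∈ S := by
    intro x
    rw [hqs, ← Finset.mem_coe, hrange]
    simp only [List.mem_map, List.mem_range, Set.mem_range]
    constructor
    · rintro ⟨i, -, rfl⟩; exact ⟨i, rfl⟩
    · intro hx
      rw [← Set.mem_range, range_eq_image_range_of_periodic (by omega) hper] at hx
      obtain ⟨i, hi, rfl⟩ := hx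
      exact ⟨i, Nat.lt_succ_of_lt hi, rfl⟩
  have hvq := (hmem v).2 hv
  let c := q.rotate v hvq
  have hc : c.IsCycle := hq.rotate hvq
  refine ⟨(c.mapLe hHG).toSubgraph, ⟨c.mapLe hHG, hc.mapLe hHG, ?_, rfl⟩, ?_, ?_⟩
  · simp [c, hqlen]
  · ext x
    simp [c, hmem]
  · intro x y hxy
    rw [Walk.toSubgraph_adj_iff] at hxy
    obtain ⟨i, he, hi⟩ := hxy
    have hi' : i < c.length := by simpa using hi
    have := c.adj_getVert_succ hi'
    simp only [Walk.mapLe, Walk.getVert_map] at he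
    rw [Sym2.eq_iff] at he
    rcases he with ⟨rfl, rfl⟩ | ⟨rfl, rfl⟩
    exacts [this, this.symm]

theorem exists_enumeration_of_mem_cyclesThrough {G : SimpleGraph V} {v : V} {k : ℕ}
    {C : G.Subgraph} (hC : C ∈ G.cyclesThrough v k) :
    3 ≤ k ∧ ∃ u : ℕ → V, (∀ i, C.Adj (u i) (u (i + 1))) ∧ (∀ i, u (i + k) = u i) ∧
      C.verts = Set.range u ∧ Set.InjOn u (Set.Iio k) := by
  obtain ⟨p, hp, rfl, rfl⟩ := hC
  have h3 := (Walk.isCycle_iff_isPath_tail_and_le_length.1 hp).2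
  have hper : ∀ i, p.getVert ((i + p.length) % p.length) = p.getVert (i % p.length) := by simp
  refine ⟨h3, fun i => p.getVert (i % p.length), ?_, hper, ?_, ?_⟩
  · intro i
    have hi : i % p.length < p.length := Nat.mod_lt _ (by omega)
    have h := p.toSubgraph_adj_getVert hi
    rcases Nat.lt_or_ge (i % p.length + 1) p.length with h' | h'
    · have : (i + 1) % p.length = i % p.length + 1 := by
        rw [Nat.add_mod, Nat.mod_eq_of_lt (a := 1) (by omega), Nat.mod_eq_of_lt h']
      simp only [this]
      exact h
    · have he : i % p.length + 1 = p.length := by omega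
      have : (i + 1) % p.length = 0 := by
        rw [Nat.add_mod, Nat.mod_eq_of_lt (a := 1) (by omega), he, Nat.mod_self]
      simp only [this, Walk.getVert_zero]
      rw [he, Walk.getVert_length] at h
      exact h
  · rw [range_eq_image_range_of_periodic (k := p.length) (by omega) hper]
    ext x
    rw [Walk.verts_toSubgraph]
    simp only [Set.mem_ofPred_eq, Walk.mem_support_iff_exists_getVert, Set.mem_image, Set.mem_Iio]
    constructor
    · rintro ⟨n, rfl, hn⟩
      rcases hn.lt_or_eq with hn | rfl
      · exact ⟨n, hn, by rw [Nat.mod_eq_of_lt hn]⟩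
      · exact ⟨0, by omega, by simp⟩
    · rintro ⟨n, hn, rfl⟩
      exact ⟨n, by rw [Nat.mod_eq_of_lt hn], hn.le⟩
  · intro i hi j hj hij
    simp only [Nat.mod_eq_of_lt hi, Nat.mod_eq_of_lt hj] at hij
    rw [Set.mem_Iio] at hi hj
    exact hp.getVert_injOn' (by simp only [Set.mem_ofPred_eq]; omega)
      (by simp only [Set.mem_ofPred_eq]; omega) hij

theorem le_egirth_of_forall_not_hasCycleOn {H : SimpleGraph V} {g : ℕ∞}
    (h : ∀ S : Finset V, (#S : ℕ∞) < g → ¬ H.HasCycleOn S) : g ≤ H.egirth := by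
  classical
  rw [le_egirth]
  intro x p hp
  obtain ⟨h3, u, h1, h2, hv, hinj⟩ :=
    exists_enumeration_of_mem_cyclesThrough (G := H) ⟨p, hp, rfl, rfl⟩
  set S := (Finset.range p.length).image u with hS
  have hcard : #S = p.length := by
    rw [hS, Finset.card_image_of_injOn, Finset.card_range]
    simpa using hinj
  by_contra hlt
  rw [not_le, ← hcard] at hlt
  refine h S hlt ⟨by omega, u, fun i => (h1 i).adj_sub, by rwa [hcard], ?_⟩
  rw [range_eq_image_range_of_periodic (k := p.length) (by omega) h2, hS]
  simp

theorem finite_cyclesThrough (G : SimpleGraph V) [G.LocallyFinite] (v : V) (k : ℕ) :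
    (G.cyclesThrough v k).Finite := by
  classical
  refine ((G.finsetWalkLength k v v).finite_toSet.image Walk.toSubgraph).subset ?_
  rintro C ⟨p, -, hp, rfl⟩
  exact ⟨p, by simpa [mem_finsetWalkLength_iff] using hp, rfl⟩

theorem finite_setOf_hasCycleOn (G : SimpleGraph V) [G.LocallyFinite] (v : V) (k : ℕ) :
    {S : Finset V | v ∈ S ∧ #S = k ∧ G.HasCycleOn S}.Finite := by
  refine Set.Finite.of_finite_image (f := fun S : Finset V => (S : Set V)) ?_
    (Finset.coe_injective.injOn)
  refine ((G.finite_cyclesThrough v k).image Subgraph.verts).subset ?_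
  rintro _ ⟨S, ⟨hv, rfl, hS⟩, rfl⟩
  obtain ⟨C, hC, hCS, -⟩ := hS.exists_mem_cyclesThrough le_rfl hv
  exact ⟨C, hC, hCS⟩

/-- A periodic sequence with values in `S` is determined by one period, so the existential over
sequences is a finite union. -/
theorem measurableSet_hasCycleOn {Ω : Type*} [MeasurableSpace Ω] {H : Ω → SimpleGraph V}
    (hH : ∀ x y, MeasurableSet {ω | (H ω).Adj x y}) (S : Finset V) :
    MeasurableSet {ω | (H ω).HasCycleOn S} := by
  set U : Set (ℕ → V) := {u | 3 ≤ #S ∧ (∀ i, u (i + #S) = u i) ∧ (S : Set V) = Set.range u} with hU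
  have hfin : U.Finite := by
    let F : (ℕ → V) → (Fin #S → V) := fun u i => u i
    refine Set.Finite.of_finite_image (f := F) ?_ ?_
    · refine (Set.Finite.pi' (fun _ : Fin #S => S.finite_toSet)).subset ?_
      rintro _ ⟨u, hu, rfl⟩ i
      rw [hu.2.2]; exact ⟨i, rfl⟩
    · intro u hu u' hu' h
      funext i
      have hmod : ∀ u ∈ U, u (i % #S) = u i := fun u hu =>
        Function.Periodic.map_mod_nat hu.2.1 i
      rw [← hmod u hu, ← hmod u' hu']
      exact congrFun h ⟨i % #S, Nat.mod_lt _ (by have := hu.1; omega)⟩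
  have : {ω | (H ω).HasCycleOn S} = ⋃ u ∈ U, ⋂ i, {ω | (H ω).Adj (u i) (u (i + 1))} := by
    ext ω
    simp only [HasCycleOn, Set.mem_ofPred_eq, Set.mem_iUnion, Set.mem_iInter, exists_prop, hU]
    constructor
    · rintro ⟨h, u, h1, h2, h3⟩; exact ⟨u, ⟨h, h2, h3⟩, h1⟩
    · rintro ⟨u, ⟨h, h2, h3⟩, h1⟩; exact ⟨h, u, h1, h2, h3⟩
  rw [this]
  exact hfin.measurableSet_biUnion fun u _ => MeasurableSet.iInter fun i => hH _ _

end Cycles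

/-! ### The kept graph and the probability of a bad set -/

section Kept

variable {V A : Type*} {G : SimpleGraph V} {Q : A → Set ℕ} {g : ℕ∞} {a : V → unitInterval}

/-- Every vertex `x` picks its neighbours whose position is in the set `Q (s x)`; those edges are
kept that are picked by one of their endpoints. -/
def keptGraph (G : SimpleGraph V) (Q : A → Set ℕ) (a : V → unitInterval) (s : V → A) :
    SimpleGraph V where
  Adj x y := G.Adj x y ∧ (G.neighborRank a x y ∈ Q (s x) ∨ G.neighborRank a y x ∈ Q (s y))
  symm := ⟨fun _ _ h => ⟨h.1.symm, h.2.symm⟩⟩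
  loopless := ⟨fun _ h => h.1.ne rfl⟩

/-- The choices for which the kept edges contain a cycle with vertex set `S`, of length less
than `g`. -/
def badChoices (G : SimpleGraph V) (Q : A → Set ℕ) (g : ℕ∞) (a : V → unitInterval)
    (S : Finset V) : Set (V → A) :=
  {s | (#S : ℕ∞) < g ∧ (G.keptGraph Q a s).HasCycleOn S}

theorem keptGraph_le (s : V → A) : G.keptGraph Q a s ≤ G := fun _ _ h => h.1

theorem HasCycleOn.mono_on {H H' : SimpleGraph V} {S : Finset V}
    (h : ∀ x ∈ S, ∀ y ∈ S, H.Adj x y → H'.Adj x y) (hS : H.HasCycleOn S) : H'.HasCycleOn S := by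
  obtain ⟨h3, u, h1, h2, hr⟩ := hS
  have hu : ∀ i, u i ∈ S := fun i => by rw [← Finset.mem_coe, hr]; exact ⟨i, rfl⟩
  exact ⟨h3, u, fun i => h _ (hu _) _ (hu _) (h1 i), h2, hr⟩

theorem dependsOnlyOn_badChoices : DependsOnlyOn (G.badChoices Q g a) := by
  intro S s s' hs h
  refine ⟨h.1, h.2.mono_on fun x hx y hy hxy => ?_⟩
  refine ⟨hxy.1, ?_⟩
  rw [← hs x hx, ← hs y hy]
  exact hxy.2

theorem neighborRank_lt_neighborRank [G.LocallyFinite] {x y z : V} (hy : G.Adj x y)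
    (h : a y < a z) : G.neighborRank a x y < G.neighborRank a x z := by
  refine Set.ncard_lt_ncard ?_ ((G.neighborSet x).toFinite.subset fun w hw => hw.1)
  refine ⟨fun w hw => ⟨hw.1, hw.2.trans h⟩, fun hss => ?_⟩
  exact lt_irrefl _ (hss ⟨hy, h⟩ : y ∈ {w | G.Adj x w ∧ a w < a y}).2

theorem neighborRank_injOn [G.LocallyFinite] (ha : Function.Injective a) (x : V) :
    Set.InjOn (G.neighborRank a x) (G.neighborSet x) := by
  intro y hy z hz h
  rcases lt_trichotomy (a y) (a z) with h' | h' | h'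
  · exact absurd h (neighborRank_lt_neighborRank hy h').ne
  · exact ha h'
  · exact absurd h (neighborRank_lt_neighborRank hz h').ne'

theorem neighborRank_lt_degree [G.LocallyFinite] {x y : V} (hy : G.Adj x y) :
    G.neighborRank a x y < G.degree x := by
  rw [← card_neighborSet_eq_degree, ← Nat.card_eq_fintype_card, Nat.card_coe_set_eq]
  refine Set.ncard_lt_ncard ?_ (G.neighborSet x).toFinite
  exact ⟨fun w hw => hw.1, fun hss => lt_irrefl _ (hss hy).2⟩

/-- With distinct labels, every position below the degree is taken. -/
theorem exists_neighborRank_eq [G.LocallyFinite] (ha : Function.Injective a) {x : V} {i : ℕ}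
    (hi : i < G.degree x) : ∃ y, G.Adj x y ∧ G.neighborRank a x y = i := by
  classical
  have hmaps : ∀ y ∈ G.neighborFinset x, G.neighborRank a x y ∈ Finset.range (G.degree x) :=
    fun y hy => Finset.mem_range.2 (neighborRank_lt_degree (by simpa using hy))
  have hinj : Set.InjOn (G.neighborRank a x) (G.neighborFinset x) := by
    intro y hy z hz
    exact neighborRank_injOn ha x (by simpa using hy) (by simpa using hz)
  have := Finset.surj_on_of_inj_on_of_card_le (s := G.neighborFinset x)
    (t := Finset.range (G.degree x)) (fun y _ => G.neighborRank a x y) hmaps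
    (fun y z hy hz h => hinj hy hz h) (by simp) i (by simpa using hi)
  obtain ⟨y, hy, h⟩ := this
  exact ⟨y, by simpa using hy, h.symm⟩

/-- If every `Q c` contains at least `δ` positions below the degree, then the kept graph has minimum
degree at least `δ`. -/
theorem le_encard_neighborSet_keptGraph [G.LocallyFinite] {d δ : ℕ} (hG : G.IsRegularOfDegree d)
    (hQ : ∀ c, (δ : ℕ∞) ≤ (Q c ∩ Set.Iio d).encard) (ha : Function.Injective a) (s : V → A)
    (x : V) : (δ : ℕ∞) ≤ ((G.keptGraph Q a s).neighborSet x).encard := by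
  refine (hQ (s x)).trans ?_
  have : Q (s x) ∩ Set.Iio d ⊆ G.neighborRank a x '' (G.keptGraph Q a s).neighborSet x := by
    rintro i ⟨hi, hid⟩
    obtain ⟨y, hy, rfl⟩ := exists_neighborRank_eq (G := G) ha (x := x) (i := i)
      (by rw [hG x]; exact hid)
    exact ⟨y, ⟨hy, Or.inl hi⟩, rfl⟩
  exact (Set.encard_le_encard this).trans (Set.encard_image_le _ _)

theorem finite_setOf_badChoices_nonempty [G.LocallyFinite] (v : V) (k : ℕ) :
    {S : Finset V | v ∈ S ∧ #S = k ∧ (G.badChoices Q g a S).Nonempty}.Finite := by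
  refine (G.finite_setOf_hasCycleOn v k).subset ?_
  rintro S ⟨hv, hk, s, hs⟩
  exact ⟨hv, hk, hs.2.mono_on fun x _ y _ h => keptGraph_le s h⟩

variable [MeasurableSpace A] [DiscreteMeasurableSpace A]

theorem measurableSet_badChoices (S : Finset V) : MeasurableSet (G.badChoices Q g a S) := by
  by_cases hg : (#S : ℕ∞) < g
  swap
  · have : G.badChoices Q g a S = ∅ := by ext s; simp [badChoices, hg]
    rw [this]; exact MeasurableSet.empty
  have : G.badChoices Q g a S = {s | (G.keptGraph Q a s).HasCycleOn S} := by
    ext s; simp [badChoices, hg]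
  rw [this]
  refine measurableSet_hasCycleOn (fun x y => ?_) S
  by_cases hxy : G.Adj x y
  · have : {s : V → A | (G.keptGraph Q a s).Adj x y} =
        (fun s => s x) ⁻¹' {c | G.neighborRank a x y ∈ Q c} ∪
        (fun s => s y) ⁻¹' {c | G.neighborRank a y x ∈ Q c} := by
      ext s; simp [keptGraph, hxy]
    rw [this]
    exact ((measurable_pi_apply x) (MeasurableSet.of_discrete)).union
      ((measurable_pi_apply y) (MeasurableSet.of_discrete))
  · have : {s : V → A | (G.keptGraph Q a s).Adj x y} = ∅ := by
      ext s; simp [keptGraph, hxy]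
    rw [this]; exact MeasurableSet.empty

/-- Union bound over the 2^k assignments of the edges to an endpoint that picks them. For a fixed
assignment the vertices are independent and every edge contributes one factor `q`. The hypothesis
`he` makes the two cycle edges at a vertex distinct, so that `h2` applies. -/
theorem measure_forall_kept_le {ν : Measure A} [IsProbabilityMeasure ν] [G.LocallyFinite]
    {q : ℝ≥0∞} (h1 : ∀ i, ν {c | i ∈ Q c} ≤ q)
    (h2 : ∀ i j, i ≠ j → ν {c | i ∈ Q c ∧ j ∈ Q c} ≤ q * q) (ha : Function.Injective a)
    {ι : Type*} [Fintype ι] {u : ι → V} (hu : Function.Injective u) (e : Equiv.Perm ι)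
    (he : ∀ i, e i ≠ e.symm i) (hadj : ∀ i, G.Adj (u i) (u (e i))) :
    Measure.infinitePi (fun _ : V => ν) {s | ∀ i, (G.keptGraph Q a s).Adj (u i) (u (e i))} ≤
      (2 * q) ^ Fintype.card ι := by
  classical
  have hadj' : ∀ i, G.Adj (u i) (u (e.symm i)) := fun i => by
    simpa using (hadj (e.symm i)).symm
  -- For `i ∈ o` the edge from `u i` to `u (e i)` is assigned to `u i`, otherwise to `u (e i)`; `D o
  -- i` collects the demands on the choice at `u i`.
  let D : Finset ι → ι → Set A := fun o i =>
    {c | (i ∈ o → G.neighborRank a (u i) (u (e i)) ∈ Q c) ∧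
      (e.symm i ∉ o → G.neighborRank a (u i) (u (e.symm i)) ∈ Q c)}
  have hD : ∀ o i, ν (D o i) ≤ (if i ∈ o then q else 1) * (if e.symm i ∉ o then q else 1) := by
    intro o i
    have hne : G.neighborRank a (u i) (u (e i)) ≠ G.neighborRank a (u i) (u (e.symm i)) :=
      fun h => he i (hu (neighborRank_injOn ha _ (hadj i) (hadj' i) h))
    by_cases hi : i ∈ o <;> by_cases hj : e.symm i ∈ o
    · simpa [D, hi, hj] using h1 _
    · simpa [D, hi, hj] using h2 _ _ hne
    · simp [D, hi, hj]
    · simpa [D, hi, hj] using h1 _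
  have hprob : ∀ o, Measure.infinitePi (fun _ : V => ν) {s | ∀ i, s (u i) ∈ D o i} ≤
      q ^ Fintype.card ι := by
    intro o
    have hset : {s : V → A | ∀ i, s (u i) ∈ D o i} =
        (fun s i => s (u i)) ⁻¹' Set.univ.pi (D o) := by ext s; simp
    rw [hset, ← Measure.map_apply (by fun_prop) (MeasurableSet.univ_pi fun i => .of_discrete),
      Measure.map_infinitePi_infinitePi_of_inj (P := fun _ : V => ν) hu, Measure.infinitePi_eq_pi,
      Measure.pi_pi]
    calc _ ≤ ∏ i, ((if i ∈ o then q else 1) * (if e.symm i ∉ o then q else 1)) :=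
          Finset.prod_le_prod' fun i _ => hD o i
      _ = ∏ i, ((if i ∈ o then q else 1) * (if i ∉ o then q else 1)) := by
          rw [Finset.prod_mul_distrib, Finset.prod_mul_distrib]
          congr 1
          exact Equiv.prod_comp e.symm fun i => if i ∉ o then q else 1
      _ = ∏ _i : ι, q := by
          refine Finset.prod_congr rfl fun i _ => ?_
          by_cases hi : i ∈ o <;> simp [hi]
      _ = q ^ Fintype.card ι := by simp
  calc _ ≤ Measure.infinitePi (fun _ : V => ν) (⋃ o : Finset ι, {s | ∀ i, s (u i) ∈ D o i}) := by
        refine measure_mono fun s hs => Set.mem_iUnion.2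
          ⟨Finset.univ.filter fun i => G.neighborRank a (u i) (u (e i)) ∈ Q (s (u i)), fun i => ⟨fun hi => ?_, fun hi => ?_⟩⟩
        · simpa using hi
        · have := (hs (e.symm i)).2
          simp only [Finset.mem_filter, Finset.mem_univ, true_and, Equiv.apply_symm_apply] at hi this
          exact this.resolve_left hi
    _ ≤ ∑' o : Finset ι, Measure.infinitePi (fun _ : V => ν) {s | ∀ i, s (u i) ∈ D o i} :=
        measure_iUnion_le _
    _ ≤ ∑' _o : Finset ι, q ^ Fintype.card ι := ENNReal.tsum_le_tsum hprob
    _ = (2 * q) ^ Fintype.card ι := by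
        rw [tsum_fintype, Finset.sum_const, Finset.card_univ, Fintype.card_finset, mul_pow]
        simp

/-- The union bound for the probability that the set `S` is bad. -/
noncomputable def cycleWeight (G : SimpleGraph V) (g : ℕ∞) (q : ℝ≥0∞) (S : Finset V) : ℝ≥0∞ :=
  ∑' C : G.Subgraph, (open Classical in
    if (#S : ℕ∞) < g ∧ (∀ v ∈ S, C ∈ G.cyclesThrough v #S) ∧ C.verts = S then (2 * q) ^ #S else 0)

theorem finRotate_ne_symm {k : ℕ} (hk : 3 ≤ k) (i : Fin k) : finRotate k i ≠ (finRotate k).symm i := by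
  obtain ⟨n, rfl⟩ : ∃ n, k = n + 1 := ⟨k - 1, by omega⟩
  rw [Ne, Equiv.eq_symm_apply, finRotate_apply, finRotate_apply]
  intro h
  have hv := congrArg Fin.val h
  rw [Fin.val_add_one, Fin.val_add_one] at hv
  simp only [Fin.ext_iff, Fin.val_add_one, Fin.val_last] at hv
  split_ifs at hv <;> omega

theorem measure_badChoices_le [Countable V] {ν : Measure A} [IsProbabilityMeasure ν]
    [G.LocallyFinite] {q : ℝ≥0∞} (h1 : ∀ i, ν {c | i ∈ Q c} ≤ q)
    (h2 : ∀ i j, i ≠ j → ν {c | i ∈ Q c ∧ j ∈ Q c} ≤ q * q) (ha : Function.Injective a)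
    (S : Finset V) :
    Measure.infinitePi (fun _ : V => ν) (G.badChoices Q g a S) ≤ G.cycleWeight g q S := by
  classical
  rcases (G.badChoices Q g a S).eq_empty_or_nonempty with he | ⟨s₀, hs₀⟩
  · simp [he]
  have hg := hs₀.1
  obtain ⟨v₀, hv₀⟩ : S.Nonempty := Finset.card_pos.1 (by have := hs₀.2.1; omega)
  set 𝒞 : Set G.Subgraph := {C | (∀ v ∈ S, C ∈ G.cyclesThrough v #S) ∧ C.verts = S} with h𝒞
  have hfin : 𝒞.Finite := (G.finite_cyclesThrough v₀ #S).subset fun C hC => hC.1 v₀ hv₀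
  have hsub : G.badChoices Q g a S ⊆
      ⋃ C ∈ 𝒞, {s | ∀ x y, C.Adj x y → (G.keptGraph Q a s).Adj x y} := by
    intro s hs
    obtain ⟨C, hC, hCS, hCa⟩ := hs.2.exists_mem_cyclesThrough (G := G) (keptGraph_le s) hv₀
    refine Set.mem_biUnion (x := C) ⟨fun v hv => ?_, hCS⟩ hCa
    obtain ⟨p, hp, hlen, rfl⟩ := hC
    have hvp : v ∈ p.support := by
      have : v ∈ p.toSubgraph.verts := by rw [hCS]; exact hv
      simpa using this
    exact ⟨p.rotate v hvp, hp.rotate hvp, by simpa using hlen, by simp⟩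
  refine (measure_mono hsub).trans ((measure_biUnion_le _ hfin.countable _).trans ?_)
  rw [cycleWeight, tsum_subtype 𝒞
    fun C => Measure.infinitePi (fun _ : V => ν) {s | ∀ x y, C.Adj x y → (G.keptGraph Q a s).Adj x y}]
  refine ENNReal.tsum_le_tsum fun C => ?_
  by_cases hC : C ∈ 𝒞
  swap
  · rw [Set.indicator_of_notMem hC]; exact zero_le
  rw [Set.indicator_of_mem hC, if_pos ⟨hg, hC⟩]
  obtain ⟨hk, u, hadj, hper, -, hinj⟩ := exists_enumeration_of_mem_cyclesThrough (hC.1 v₀ hv₀)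
  have hstep : ∀ i : Fin #S, u (finRotate #S i) = u (i + 1) := by
    intro i
    obtain ⟨n, hn⟩ : ∃ n, #S = n + 1 := ⟨#S - 1, by omega⟩
    revert i
    rw [hn] at hper ⊢
    intro i
    rw [finRotate_apply]
    by_cases hi : i = Fin.last n
    · subst hi
      simp only [Fin.last_add_one, Fin.val_zero, Fin.val_last]
      simpa using (hper 0).symm
    · rw [Fin.val_add_one_of_lt (Fin.lt_last_iff_ne_last.2 hi)]
  have := measure_forall_kept_le (G := G) h1 h2 ha (u := fun i : Fin #S => u i)
    (fun i j hij => Fin.ext (hinj i.2 j.2 hij)) (finRotate #S) (finRotate_ne_symm hk)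
    (fun i => by rw [hstep]; exact (hadj i).adj_sub)
  rw [Fintype.card_fin] at this
  refine (measure_mono fun s hs i => ?_).trans this
  rw [hstep]
  exact hs _ _ (hadj i)

/-- Each cycle has only one vertex set, so summing over sets around `v` counts each cycle through
`v` at most once. The factor 4 is 2 from the endpoint assignments times 2 from 2^|S|. -/
theorem tsum_cycleWeight_le (G : SimpleGraph V) [G.LocallyFinite] (g : ℕ∞) (q : ℝ≥0∞) (v : V) :
    ∑' S : Finset V, (open Classical in if v ∈ S then G.cycleWeight g q S * 2 ^ #S else 0) ≤
      ∑' k : ℕ, (open Classical in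
        if (k : ℕ∞) < g then (G.cyclesThrough v k).ncard * (4 * q) ^ k else 0) := by
  classical
  let h : G.Subgraph → ℕ → ℝ≥0∞ := fun C k =>
    if (k : ℕ∞) < g ∧ C ∈ G.cyclesThrough v k then (4 * q) ^ k else 0
  calc _ ≤ ∑' S : Finset V, ∑' C : G.Subgraph, (if C.verts = S then h C #S else 0) := by
        refine ENNReal.tsum_le_tsum fun S => ?_
        split_ifs with hv
        swap; · exact zero_le
        rw [cycleWeight, ← ENNReal.tsum_mul_right]
        refine ENNReal.tsum_le_tsum fun C => ?_
        split_ifs with h1 h2 h2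
        · simp only [h]
          rw [if_pos ⟨h1.1, h1.2.1 v hv⟩, ← mul_pow]
          refine le_of_eq ?_
          congr 1
          rw [mul_right_comm]; norm_num
        · exact absurd h1.2.2 h2
        all_goals simp
    _ = ∑' C : G.Subgraph, ∑' S : Finset V, (if C.verts = S then h C #S else 0) :=
        ENNReal.tsum_comm
    _ ≤ ∑' C : G.Subgraph, ∑' k, h C k := by
        refine ENNReal.tsum_le_tsum fun C => ?_
        by_cases hex : ∃ S : Finset V, C.verts = S
        · obtain ⟨S, hS⟩ := hex
          rw [tsum_eq_single S]
          · rw [if_pos hS]; exact ENNReal.le_tsum _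
          · intro S' hne
            rw [if_neg]
            intro h'
            exact hne (Finset.coe_injective (h'.symm.trans hS))
        · refine le_trans (le_of_eq ?_) zero_le
          rw [ENNReal.tsum_eq_zero]
          exact fun S => if_neg fun hS => hex ⟨S, hS⟩
    _ = ∑' k, ∑' C : G.Subgraph, h C k := ENNReal.tsum_comm
    _ ≤ _ := by
        refine ENNReal.tsum_le_tsum fun k => ?_
        split_ifs with hk
        · have : ∀ C, h C k = (G.cyclesThrough v k).indicator (fun _ => (4 * q) ^ k) C := by
            intro C
            simp [h, hk, Set.indicator_apply]
          simp_rw [this]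
          rw [← _root_.tsum_subtype, ENNReal.tsum_set_const,
            (G.finite_cyclesThrough v k).cast_ncard_eq.symm]
          simp
        · refine le_of_eq ?_
          rw [ENNReal.tsum_eq_zero]
          exact fun C => if_neg fun h => hk h.1

theorem ncard_cyclesThrough_mul_le [G.LocallyFinite] {d δ : ℕ} (hδ : 0 < δ)
    (hG : G.FewShortCycles d δ g) {k : ℕ} (hk : (k : ℕ∞) < g) (v : V) :
    ((G.cyclesThrough v k).ncard : ℝ≥0∞) * (4 * ((d / δ : ℕ) : ℝ≥0∞)⁻¹) ^ k ≤ 2⁻¹ ^ (k + 1) := by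
  rcases (G.cyclesThrough v k).eq_empty_or_nonempty with he | ⟨C, hC⟩
  · simp [he]
  have hk3 := (exists_enumeration_of_mem_cyclesThrough hC).1
  have hpos : 0 < (G.cyclesThrough v k).ncard :=
    (Set.ncard_pos (G.finite_cyclesThrough v k)).2 ⟨C, hC⟩
  have hle := hG k hk v
  have hδ' : (0 : ℝ) < δ := by exact_mod_cast hδ
  have hd : 12 * δ ≤ d := by
    by_contra hlt
    push Not at hlt
    have hlt' : (d : ℝ) < 12 * δ := by exact_mod_cast hlt
    have h1 : ((d : ℝ) / (12 * δ)) ^ k < 1 := by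
      refine pow_lt_one₀ (by positivity) ?_ (by omega)
      rw [div_lt_one (by positivity)]; exact hlt'
    have h2 : (1 : ℝ) ≤ (G.cyclesThrough v k).ncard := by exact_mod_cast hpos
    linarith
  set m := d / δ with hm
  have hm12 : 12 ≤ m := by rw [hm, Nat.le_div_iff_mul_le hδ]; exact hd
  have hm12' : (12 : ℝ) ≤ m := by exact_mod_cast hm12
  have hdm : (d : ℝ) ≤ δ * (m + 1) := by
    have := Nat.lt_mul_div_succ d hδ
    exact_mod_cast this.le
  have hreal : ((G.cyclesThrough v k).ncard : ℝ) * (4 * (m : ℝ)⁻¹) ^ k ≤ (1 / 2) ^ (k + 1) := by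
    have hm0 : (0 : ℝ) < m := by linarith
    calc _ ≤ ((d : ℝ) / (12 * δ)) ^ k * (4 * (m : ℝ)⁻¹) ^ k := by gcongr
      _ = ((d : ℝ) / (12 * δ) * (4 * (m : ℝ)⁻¹)) ^ k := (mul_pow _ _ _).symm
      -- The base is d/(3δm) ≤ (m+1)/(3m) ≤ 13/36 < 3/8, by d ≤ δ(m+1) and m ≥ 12. The slack against
      -- 1/2 gives, for k ≥ 3, the extra factor (3/4)^3 < 1/2.
      _ ≤ (3 / 8) ^ k := by
          refine pow_le_pow_left₀ (by positivity) ?_ k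
          rw [show (d : ℝ) / (12 * δ) * (4 * (m : ℝ)⁻¹) = d / (3 * δ * m) by field_simp; ring,
            div_le_iff₀ (by positivity)]
          nlinarith
      _ = (1 / 2) ^ k * (3 / 4) ^ k := by rw [← mul_pow]; norm_num
      _ ≤ (1 / 2) ^ k * (3 / 4) ^ 3 := by
          refine mul_le_mul_of_nonneg_left ?_ (by positivity)
          exact pow_le_pow_of_le_one (by norm_num) (by norm_num) hk3
      _ ≤ (1 / 2) ^ (k + 1) := by
          rw [pow_succ]; exact mul_le_mul_of_nonneg_left (by norm_num) (by positivity)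
  have h := ENNReal.ofReal_le_ofReal hreal
  have hm0 : (0 : ℝ) < m := by linarith
  rw [ENNReal.ofReal_mul (by positivity), ENNReal.ofReal_natCast,
    ENNReal.ofReal_pow (by positivity), ENNReal.ofReal_mul (by norm_num),
    ENNReal.ofReal_inv_of_pos hm0, ENNReal.ofReal_natCast, ENNReal.ofReal_pow (by norm_num)] at h
  simpa using h

theorem tsum_cycleWeight_le_one [G.LocallyFinite] {d δ : ℕ} (hδ : 0 < δ)
    (hG : G.FewShortCycles d δ g) (v : V) :
    ∑' S : Finset V, (open Classical in
      if v ∈ S then G.cycleWeight g ((d / δ : ℕ) : ℝ≥0∞)⁻¹ S * 2 ^ #S else 0) ≤ 1 := by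
  classical
  refine (G.tsum_cycleWeight_le g _ v).trans ?_
  calc _ ≤ ∑' k : ℕ, (2⁻¹ : ℝ≥0∞) ^ (k + 1) := by
        refine ENNReal.tsum_le_tsum fun k => ?_
        split_ifs with hk
        · exact ncard_cyclesThrough_mul_le hδ hG hk v
        · exact zero_le
    _ = 1 := by
        rw [ENNReal.tsum_geometric_add_one, ENNReal.one_sub_inv_two, inv_inv,
          ENNReal.inv_mul_cancel (by norm_num) (by norm_num)]

end Kept

end SimpleGraph

/-! ### Locality of the resampling process -/

namespace SimpleGraph

open Finset

section Locality

variable {V W A : Type*}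

/-- The map `ι` embeds `H` into `G` in such a way that the vertices `w` with `R w ≥ 1` have the same
neighbours in both graphs, and `R` decreases at most by one along edges. -/
structure IsLocalEmbedding (H : SimpleGraph W) (G : SimpleGraph V) (ι : W → V) (R : W → ℕ) :
    Prop where
  injective : Function.Injective ι
  map_adj : ∀ w w', H.Adj w w' → G.Adj (ι w) (ι w')
  exists_adj : ∀ w, 1 ≤ R w → ∀ y, G.Adj (ι w) y → ∃ w', H.Adj w w' ∧ ι w' = y
  depth : ∀ w w', H.Adj w w' → R w ≤ R w' + 1

variable {H : SimpleGraph W} {G : SimpleGraph V} {ι : W → V} {R : W → ℕ} {Q : A → Set ℕ} {g : ℕ∞}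
  {a : V → unitInterval}

namespace IsLocalEmbedding

/-- This allows the lifting lemma to be used inside `H` itself, where it bounds how far the depth
drops along a cycle. -/
theorem refl_of_depth (h : ∀ w w', H.Adj w w' → R w ≤ R w' + 1) : IsLocalEmbedding H H id R where
  injective := Function.injective_id
  map_adj _ _ h := h
  exists_adj _ _ y h := ⟨y, h, rfl⟩
  depth := h

theorem adj_iff (h : IsLocalEmbedding H G ι R) {x y : W} (hx : 1 ≤ R x) :
    G.Adj (ι x) (ι y) ↔ H.Adj x y := by
  refine ⟨fun hxy => ?_, h.map_adj x y⟩
  obtain ⟨w, hw, he⟩ := h.exists_adj x hx _ hxy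
  rwa [← h.injective he]

theorem neighborRank_eq (h : IsLocalEmbedding H G ι R) (f : V → unitInterval) {x : W}
    (hx : 1 ≤ R x) (y : W) :
    G.neighborRank f (ι x) (ι y) = H.neighborRank (f ∘ ι) x y := by
  rw [neighborRank, neighborRank, ← Set.ncard_image_of_injective _ h.injective]
  congr 1
  ext z
  constructor
  · rintro ⟨hz, hlt⟩
    obtain ⟨w, hw, rfl⟩ := h.exists_adj x hx z hz
    exact ⟨w, ⟨hw, hlt⟩, rfl⟩
  · rintro ⟨w, ⟨hw, hlt⟩, rfl⟩
    exact ⟨h.map_adj _ _ hw, hlt⟩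

theorem keptGraph_adj_iff (h : IsLocalEmbedding H G ι R) {s : V → A} {s' : W → A} {x y : W}
    (hx : 1 ≤ R x) (hy : 1 ≤ R y) (hsx : s (ι x) = s' x) (hsy : s (ι y) = s' y) :
    (G.keptGraph Q a s).Adj (ι x) (ι y) ↔ (H.keptGraph Q (a ∘ ι) s').Adj x y := by
  simp only [keptGraph, h.adj_iff hx, h.neighborRank_eq a hx, h.neighborRank_eq a hy, hsx, hsy]

theorem hasCycleOn_map_iff (h : IsLocalEmbedding H G ι R) {s : V → A} {s' : W → A} {S : Finset W}
    (hS : ∀ x ∈ S, 1 ≤ R x ∧ s (ι x) = s' x) :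
    (G.keptGraph Q a s).HasCycleOn (S.map ⟨ι, h.injective⟩) ↔
      (H.keptGraph Q (a ∘ ι) s').HasCycleOn S := by
  simp only [HasCycleOn, Finset.card_map, Finset.coe_map, Function.Embedding.coeFn_mk]
  refine and_congr_right fun _ => ⟨?_, ?_⟩
  · rintro ⟨u, h1, h2, h3⟩
    have hu : ∀ i, ∃ x ∈ S, ι x = u i := fun i => by
      have : u i ∈ ι '' (S : Set W) := by rw [h3]; exact ⟨i, rfl⟩
      simpa using this
    choose u' hu' hue using hu
    refine ⟨u', fun i => ?_, fun i => h.injective (by rw [hue, hue, h2]), ?_⟩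
    · rw [← h.keptGraph_adj_iff (hS _ (hu' i)).1 (hS _ (hu' _)).1 (hS _ (hu' i)).2 (hS _ (hu' _)).2,
        hue, hue]
      exact h1 i
    · ext x
      constructor
      · intro hx
        have : ι x ∈ Set.range u := by rw [← h3]; exact ⟨x, hx, rfl⟩
        obtain ⟨i, hi⟩ := this
        exact ⟨i, h.injective (by rw [hue, hi])⟩
      · rintro ⟨i, rfl⟩; exact hu' i
  · rintro ⟨u, h1, h2, h3⟩
    have hu : ∀ i, u i ∈ S := fun i => by rw [← Finset.mem_coe, h3]; exact ⟨i, rfl⟩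
    refine ⟨ι ∘ u, fun i => ?_, fun i => congrArg ι (h2 i), by rw [h3, Set.range_comp]⟩
    exact (h.keptGraph_adj_iff (hS _ (hu i)).1 (hS _ (hu _)).1 (hS _ (hu i)).2 (hS _ (hu _)).2).2
      (h1 i)

/-- The cycle is lifted step by step from `w`; each step costs at most one unit of depth, and fewer
than `#S` steps reach all its vertices. -/
theorem exists_map_eq_of_hasCycleOn (h : IsLocalEmbedding H G ι R) {Γ : SimpleGraph V}
    (hΓ : Γ ≤ G) {S : Finset V} (hS : Γ.HasCycleOn S) {w : W} (hw : ι w ∈ S) (hR : #S ≤ R w) :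
    ∃ S' : Finset W, S'.map ⟨ι, h.injective⟩ = S ∧ w ∈ S' ∧ ∀ x ∈ S', R w ≤ R x + #S := by
  classical
  obtain ⟨h3, u, h1, h2, hr⟩ := hS
  obtain ⟨j₀, hj₀⟩ : ι w ∈ Set.range u := by rw [← hr]; exact hw
  have hlift : ∀ j ≤ R w, ∃ x, ι x = u (j₀ + j) ∧ R w ≤ R x + j := by
    intro j
    induction j with
    | zero => exact fun _ => ⟨w, by simpa using hj₀.symm, by simp⟩
    | succ j ih =>
      intro hj
      obtain ⟨x, hx, hxR⟩ := ih (by omega)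
      have hadj := hΓ (h1 (j₀ + j))
      rw [← hx] at hadj
      obtain ⟨x', hx', he⟩ := h.exists_adj x (by omega) _ hadj
      have := h.depth x x' hx'
      exact ⟨x', by rw [he, add_assoc], by omega⟩
  have hall : ∀ y ∈ S, ∃ x, ι x = y ∧ R w ≤ R x + #S := by
    intro y hy
    obtain ⟨i, rfl⟩ : y ∈ Set.range u := by rw [← hr]; exact hy
    have hper : Function.Periodic u #S := h2
    have hy' : u i ∈ Set.range fun j => u (j₀ + j) := by
      -- Adding `j₀` periods to the index `i` makes it at least `j₀`.
      refine ⟨i + j₀ * (#S - 1), ?_⟩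
      have : j₀ + (i + j₀ * (#S - 1)) = i + j₀ * #S := by
        obtain ⟨k, hk⟩ : ∃ k, #S = k + 1 := ⟨#S - 1, by omega⟩
        rw [hk]; simp only [Nat.add_sub_cancel]; ring
      simp only [this]
      exact hper.nat_mul j₀ i
    rw [range_eq_image_range_of_periodic (k := #S) (by omega)
      (fun i => by rw [← add_assoc]; exact h2 _)] at hy'
    obtain ⟨j, hj, hje⟩ := hy'
    have hj : j < #S := hj
    obtain ⟨x, hx, hxR⟩ := hlift j (by omega)
    exact ⟨x, by rw [hx, ← hje], by omega⟩
  refine ⟨S.preimage ι h.injective.injOn, ?_, by simpa using hw, ?_⟩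
  · ext y
    simp only [Finset.mem_map, Finset.mem_preimage, Function.Embedding.coeFn_mk]
    constructor
    · rintro ⟨x, hx, rfl⟩; exact hx
    · intro hy
      obtain ⟨x, rfl, -⟩ := hall y hy
      exact ⟨x, hy, rfl⟩
  · intro x hx
    obtain ⟨x', he, hR'⟩ := hall (ι x) (by simpa using hx)
    rwa [h.injective he] at hR'

end IsLocalEmbedding

/-- A radius of a neighbourhood that determines the counters at time `t`. -/
def resamplingRadius : ℕ → ℕ
  | 0 => 0
  | t + 1 => resamplingRadius t + 2 * (resamplingSchedule t).1 + 1

/-- A round depends on the current choices and neighbourhoods along the candidate cycles through `w`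
and along the candidates that meet these, all of size `k`; so it looks `2k + 1` further. -/
theorem IsLocalEmbedding.resampleCounter_eq (h : IsLocalEmbedding H G ι R) (r : V × ℕ → A) (t : ℕ) :
    ∀ w, resamplingRadius t ≤ R w →
      resampleCounter (G.badChoices Q g a) a r t (ι w) =
        resampleCounter (H.badChoices Q g (a ∘ ι)) (a ∘ ι) (fun p => r (ι p.1, p.2)) t w := by
  induction t with
  | zero => intro w _; rfl
  | succ t ih =>
    set q := resamplingSchedule t with hq
    set s : V → A := fun w => r (w, resampleCounter (G.badChoices Q g a) a r t w) with hs
    set s' : W → A := fun w => r (ι w, resampleCounter (H.badChoices Q g (a ∘ ι)) (a ∘ ι)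
      (fun p => r (ι p.1, p.2)) t w) with hs'
    have hact : ∀ S : Finset W, (∀ x ∈ S, resamplingRadius t + 1 ≤ R x) →
        (IsActive q a {S | s ∈ G.badChoices Q g a S} (S.map ⟨ι, h.injective⟩) ↔
          IsActive q (a ∘ ι) {S | s' ∈ H.badChoices Q g (a ∘ ι) S} S) := by
      intro S hS
      have := h.hasCycleOn_map_iff (Q := Q) (a := a) (s := s) (s' := s') (S := S) fun x hx =>
        ⟨by have := hS x hx; omega, by simp only [hs, hs']; rw [ih x (by have := hS x hx; omega)]⟩
      simp only [IsActive, badChoices, Set.mem_ofPred_eq, Finset.card_map, this,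
        Finset.forall_mem_map, Function.Embedding.coeFn_mk, Function.comp_apply]
    have hdepth : ∀ S, IsActive q (a ∘ ι) {S | s' ∈ H.badChoices Q g (a ∘ ι) S} S → ∀ x ∈ S,
        q.1 ≤ R x → ∀ y ∈ S, R x ≤ R y + q.1 := by
      intro S hS x hx hxR y hy
      have hcard : #S = q.1 := hS.2.1
      obtain ⟨S', hS', -, hd⟩ := (refl_of_depth h.depth).exists_map_eq_of_hasCycleOn
        (keptGraph_le s') hS.1.2 (w := x) hx (by omega)
      have hy' : y ∈ S' := by
        rw [← hS'] at hy; simpa using hy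
      rw [← hcard]
      exact hd y hy'
    have hlift : ∀ S, IsActive q a {S | s ∈ G.badChoices Q g a S} S → ∀ x, ι x ∈ S → q.1 ≤ R x →
        ∃ S' : Finset W, S'.map ⟨ι, h.injective⟩ = S ∧ x ∈ S' ∧ ∀ y ∈ S', R x ≤ R y + q.1 := by
      intro S hS x hx hxR
      have hcard : #S = q.1 := hS.2.1
      have := h.exists_map_eq_of_hasCycleOn (keptGraph_le s) hS.1.2 hx (by omega)
      rwa [hcard] at this
    -- A competitor that meets `S` may lose another `q.1` of depth. The remaining 1 ensures that
    -- neighbour ranks agree along it even if `resamplingRadius t` is 0.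
    have hsel : ∀ S : Finset W, (∀ x ∈ S, resamplingRadius t + q.1 + 1 ≤ R x) →
        (IsSelected q a {S | s ∈ G.badChoices Q g a S} (S.map ⟨ι, h.injective⟩) ↔
          IsSelected q (a ∘ ι) {S | s' ∈ H.badChoices Q g (a ∘ ι) S} S) := by
      intro S hS
      refine and_congr (hact S fun x hx => by have := hS x hx; omega) ⟨?_, ?_⟩
      · intro hG S' hS' hne
        by_contra hdis
        obtain ⟨x, hx', hx⟩ := Finset.not_disjoint_iff.1 hdis
        have hSx := hS x hx
        have hd := hdepth S' hS' x hx' (by omega)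
        have := hG _ ((hact S' fun y hy => by have := hd y hy; omega).2 hS')
          (fun he => hne (Finset.map_injective _ he))
        exact hdis ((Finset.disjoint_map _).1 this)
      · intro hH S'' hS'' hne
        by_contra hdis
        obtain ⟨y, hy', hy⟩ := Finset.not_disjoint_iff.1 hdis
        obtain ⟨x, hx, rfl⟩ := Finset.mem_map.1 hy
        have hSx := hS x hx
        obtain ⟨S', rfl, -, hd⟩ := hlift S'' hS'' x hy' (by omega)
        have := hH S' ((hact S' fun y hy => by have := hd y hy; omega).1 hS'')
          (fun he => hne (by rw [he]))
        exact hdis ((Finset.disjoint_map _).2 this)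
    intro w hw
    have hw' : resamplingRadius t + 2 * q.1 + 1 ≤ R w := hw
    simp only [resampleCounter]
    rw [ih w (by omega)]
    classical
    congr 1
    refine if_congr ⟨?_, ?_⟩ rfl rfl
    · rintro ⟨S, hS, hwS⟩
      obtain ⟨S', rfl, hwS', hd⟩ := hlift S hS.1 w hwS (by omega)
      exact ⟨S', (hsel S' fun y hy => by have := hd y hy; omega).1 hS, hwS'⟩
    · rintro ⟨S, hS, hwS⟩
      have hd := hdepth S hS.1 w hwS (by omega)
      exact ⟨_, (hsel S fun y hy => by have := hd y hy; omega).2 hS, Finset.mem_map_of_mem _ hwS⟩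

/-- The edges kept at time `t` if the labels are decoded by `α` and `τ` into labels that govern the
resampling, and sequences of choices. -/
noncomputable def keptAt (G : SimpleGraph V) (Q : A → Set ℕ) (g : ℕ∞)
    (α : unitInterval → unitInterval) (τ : unitInterval → ℕ → A) (f : V → unitInterval) (t : ℕ) :
    SimpleGraph V :=
  G.keptGraph Q (α ∘ f) fun v => τ (f v)
    (resampleCounter (G.badChoices Q g (α ∘ f)) (α ∘ f) (fun p => τ (f p.1) p.2) t v)

/-- Some edge kept at time `t` leads from `x` to the neighbour of `x` in position `i`. -/
def KeepsPosition (G : SimpleGraph V) (Q : A → Set ℕ) (g : ℕ∞)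
    (α : unitInterval → unitInterval) (τ : unitInterval → ℕ → A) (f : V → unitInterval) (t : ℕ)
    (x : V) (i : ℕ) : Prop :=
  ∃ y, (G.keptAt Q g α τ f t).Adj x y ∧ G.neighborRank f x y = i

variable {α : unitInterval → unitInterval} {τ : unitInterval → ℕ → A}

theorem IsLocalEmbedding.keepsPosition_iff (h : IsLocalEmbedding H G ι R) (f : V → unitInterval)
    {t : ℕ} {x : W} (hx : resamplingRadius t + 2 ≤ R x) (i : ℕ) :
    G.KeepsPosition Q g α τ f t (ι x) i ↔ H.KeepsPosition Q g α τ (f ∘ ι) t x i := by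
  have hc : ∀ w, resamplingRadius t ≤ R w → τ (f (ι w)) (resampleCounter
      (G.badChoices Q g (α ∘ f)) (α ∘ f) (fun p => τ (f p.1) p.2) t (ι w)) = τ ((f ∘ ι) w)
      (resampleCounter (H.badChoices Q g (α ∘ f ∘ ι)) (α ∘ f ∘ ι)
        (fun p => τ ((f ∘ ι) p.1) p.2) t w) := by
    intro w hw
    rw [h.resampleCounter_eq _ t w hw]
    rfl
  have key : ∀ y, H.Adj x y → ((G.keptAt Q g α τ f t).Adj (ι x) (ι y) ↔
      (H.keptAt Q g α τ (f ∘ ι) t).Adj x y) := by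
    intro y hy
    have := h.depth x y hy
    exact h.keptGraph_adj_iff (by omega) (by omega) (hc x (by omega)) (hc y (by omega))
  constructor
  · rintro ⟨y, hy, hi⟩
    obtain ⟨w, hw, rfl⟩ := h.exists_adj x (by omega) y hy.1
    exact ⟨w, (key w hw).1 hy, by rw [← h.neighborRank_eq f (by omega), hi]⟩
  · rintro ⟨y, hy, hi⟩
    exact ⟨ι y, (key y hy.1).2 hy, by rw [h.neighborRank_eq f (by omega), hi]⟩

/-- A component contains all neighbours of its vertices, so any constant depth is allowed. -/
theorem isLocalEmbedding_component (G : SimpleGraph V) (x : V) (n : ℕ) :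
    IsLocalEmbedding (G.connectedComponentMk x).toSimpleGraph G Subtype.val fun _ => n where
  injective := Subtype.val_injective
  map_adj _ _ h := h
  exists_adj w _ y hy := by
    refine ⟨⟨y, ?_⟩, hy, rfl⟩
    have hw : G.connectedComponentMk w = G.connectedComponentMk x := w.2
    change G.connectedComponentMk y = G.connectedComponentMk x
    rw [← hw]
    exact ConnectedComponent.sound hy.symm.reachable
  depth _ _ _ := by omega

theorem keepsPosition_rootedComponent {b : ℕ} (hG : ∀ v, (G.neighborSet v).encard ≤ b)
    (f : V → unitInterval) (x : V) (t i : ℕ) :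
    (G.rootedComponent hG f x).graph.KeepsPosition Q g α τ (G.rootedComponent hG f x).label t
      (G.rootedComponent hG f x).root i ↔ G.KeepsPosition Q g α τ f t x i :=
  ((isLocalEmbedding_component G x (resamplingRadius t + 2)).keepsPosition_iff f
    (x := ⟨x, rfl⟩) le_rfl i).symm

end Locality

end SimpleGraph

/-! ### Measurability of events determined by a ball of given radius -/

namespace LabeledRootedGraph

open SimpleGraph

variable {b : ℕ}

theorem root_mem_ball (X : LabeledRootedGraph.{u} b) (r : ℕ) : X.root ∈ X.ball r := by
  simp [ball]

theorem finite_ball (X : LabeledRootedGraph.{u} b) (r : ℕ) : (X.ball r).Finite := by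
  induction r with
  | zero =>
    refine (Set.finite_singleton X.root).subset fun v hv => ?_
    have hv : X.graph.dist X.root v ≤ 0 := hv
    exact (X.connected.dist_eq_zero_iff.1 (by omega)).symm
  | succ r ih =>
    have hn : ∀ v, (X.graph.neighborSet v).Finite := fun v =>
      Set.finite_of_encard_le_coe (X.degree_le v)
    refine (ih.union (ih.biUnion fun v _ => hn v)).subset fun v hv => ?_
    have hv : X.graph.dist X.root v ≤ r + 1 := hv
    obtain ⟨p, hp⟩ := X.connected.exists_walk_length_eq_dist v X.root
    rw [dist_comm] at hp
    cases p with
    | nil => exact Or.inl (X.root_mem_ball r)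
    | @cons _ w _ h p =>
      refine Or.inr (Set.mem_biUnion (x := w) ?_ h.symm)
      have := dist_le p
      rw [Walk.length_cons] at hp
      rw [dist_comm] at this
      change X.graph.dist X.root w ≤ r
      omega

theorem ball_mono (X : LabeledRootedGraph.{u} b) {r s : ℕ} (h : r ≤ s) : X.ball r ⊆ X.ball s :=
  fun _ hv => le_trans hv h

theorem exists_walk_induce_ball (X : LabeledRootedGraph.{u} b) {r : ℕ} (v : X.ball r) :
    ∃ p : (X.graph.induce (X.ball r)).Walk ⟨X.root, X.root_mem_ball r⟩ v, p.length ≤ r := by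
  classical
  obtain ⟨p, hp⟩ := X.connected.exists_walk_length_eq_dist X.root v
  have hv : X.graph.dist X.root v ≤ r := v.2
  have hs : ∀ x ∈ p.support, x ∈ X.ball r := by
    intro x hx
    have h1 := dist_le (p.takeUntil x hx)
    have h2 := p.length_takeUntil_le_length hx
    change X.graph.dist X.root x ≤ r
    omega
  refine ⟨p.induce _ hs, ?_⟩
  have := congrArg Walk.length (p.map_induce hs)
  rw [Walk.length_map] at this
  exact this.trans_le (hp.trans_le hv)

/-- The labelled rooted graphs whose ball of radius `r` is isomorphic to `(K, o)`, with labels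
in `B`. -/
def ballCylinder (b r : ℕ) {n : ℕ} (K : SimpleGraph (Fin n)) (o : Fin n)
    (B : Set (Fin n → unitInterval)) : Set (LabeledRootedGraph.{u} b) :=
  {X | ∃ e : X.graph.induce (X.ball r) ≃g K,
    (e.symm o : X.V) = X.root ∧ (fun i => X.label (e.symm i : X.V)) ∈ B}

theorem measurableSet_cylinder {n : ℕ} (K : SimpleGraph (Fin n)) (o : Fin n)
    {B : Set (Fin n → unitInterval)} (hB : MeasurableSet B) :
    MeasurableSet (cylinder.{u} b K o B) :=
  MeasurableSpace.measurableSet_generateFrom ⟨n, K, o, B, hB, rfl⟩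

theorem ncard_ball_of_mem_ballCylinder {r n : ℕ} {K : SimpleGraph (Fin n)} {o : Fin n}
    {B : Set (Fin n → unitInterval)} {X : LabeledRootedGraph.{u} b}
    (h : X ∈ ballCylinder b r K o B) : (X.ball r).ncard = n := by
  obtain ⟨e, -⟩ := h
  rw [← Nat.card_coe_set_eq, Nat.card_congr e.toEquiv, Nat.card_fin]

theorem exists_mem_ballCylinder (X : LabeledRootedGraph.{u} b) (r : ℕ) :
    ∃ (n : ℕ) (K : SimpleGraph (Fin n)) (o : Fin n) (e : X.graph.induce (X.ball r) ≃g K),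
      (e.symm o : X.V) = X.root := by
  have := (X.finite_ball r).fintype
  let e := (X.graph.induce (X.ball r)).overFinIso rfl
  exact ⟨_, _, e ⟨X.root, X.root_mem_ball r⟩, e, by simp⟩

instance {n : ℕ} : Countable (SimpleGraph (Fin n)) := by
  have : Finite (SimpleGraph (Fin n)) := inferInstance
  infer_instance

/-- Cylinders leave the radius free. A ball that contains more than `n` vertices within distance `r`
of the root still certifies the inequality, whatever its own radius is. -/
theorem measurableSet_lt_ncard_ball (r n : ℕ) :
    MeasurableSet {X : LabeledRootedGraph.{u} b | n < (X.ball r).ncard} := by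
  -- Walks replace `dist` in `K`, since `dist` is 0 between different components.
  have : {X : LabeledRootedGraph.{u} b | n < (X.ball r).ncard} =
      ⋃ (m : ℕ) (K : SimpleGraph (Fin m)) (o : Fin m)
        (_ : n < {v | ∃ p : K.Walk o v, p.length ≤ r}.ncard), cylinder b K o Set.univ := by
    ext X
    simp only [Set.mem_ofPred_eq, Set.mem_iUnion, exists_prop]
    constructor
    · intro h
      obtain ⟨m, K, o, e, he⟩ := X.exists_mem_ballCylinder r
      refine ⟨m, K, o, ?_, r, e, he, Set.mem_univ _⟩
      have hall : {v | ∃ p : K.Walk o v, p.length ≤ r} = Set.univ := by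
        refine Set.eq_univ_of_forall fun v => ?_
        obtain ⟨p, hp⟩ := X.exists_walk_induce_ball (e.symm v)
        have h1 : e ⟨X.root, X.root_mem_ball r⟩ = o := by
          rw [← e.apply_symm_apply o]; congr 1; exact Subtype.ext he.symm
        exact ⟨(p.map e.toHom).copy h1 (e.apply_symm_apply v), by simpa using hp⟩
      rw [hall, Set.ncard_univ, Nat.card_fin]
      rwa [ncard_ball_of_mem_ballCylinder (B := Set.univ) ⟨e, he, Set.mem_univ _⟩] at h
    · rintro ⟨m, K, o, h, r', e, he, -⟩
      refine h.trans_le ?_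
      have hinj : Function.Injective fun v : Fin m => (e.symm v : X.V) :=
        Subtype.val_injective.comp e.symm.injective
      rw [← Set.ncard_image_of_injective _ hinj]
      refine Set.ncard_le_ncard ?_ (X.finite_ball r)
      rintro _ ⟨v, ⟨p, hp⟩, rfl⟩
      let φ : K →g X.graph := (Embedding.induce (X.ball r')).toHom.comp e.symm.toHom
      have h1 := dist_le (p.map φ)
      rw [Walk.length_map] at h1
      have h2 : φ o = X.root := he
      rw [h2] at h1
      exact h1.trans hp
  rw [this]
  exact MeasurableSet.iUnion fun m => MeasurableSet.iUnion fun K => MeasurableSet.iUnion fun o =>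
    MeasurableSet.iUnion fun _ => measurableSet_cylinder K o MeasurableSet.univ

/-- Balls around the root are nested, so among finite balls the number of vertices identifies the
ball: fixing it recovers the radius-`r` ball from a cylinder with free radius. -/
theorem measurableSet_ballCylinder (r : ℕ) {n : ℕ} (K : SimpleGraph (Fin n)) (o : Fin n)
    {B : Set (Fin n → unitInterval)} (hB : MeasurableSet B) :
    MeasurableSet (ballCylinder.{u} b r K o B) := by
  have hn : 0 < n := Fin.pos o
  have : ballCylinder.{u} b r K o B = cylinder b K o B ∩
      ({X | n - 1 < (X.ball r).ncard} \ {X | n < (X.ball r).ncard}) := by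
    ext X
    constructor
    · intro h
      have := ncard_ball_of_mem_ballCylinder h
      refine ⟨⟨r, h⟩, ?_, ?_⟩
      · change n - 1 < _; omega
      · change ¬ n < _; omega
    · rintro ⟨⟨r', h⟩, h1, h2⟩
      have h1 : n - 1 < (X.ball r).ncard := h1
      have h2 : ¬ n < (X.ball r).ncard := h2
      have hr' := ncard_ball_of_mem_ballCylinder (r := r') h
      have heq : X.ball r' = X.ball r := by
        rcases le_total r r' with hle | hle
        · exact (Set.eq_of_subset_of_ncard_le (X.ball_mono hle) (by omega) (X.finite_ball r')).symm
        · exact Set.eq_of_subset_of_ncard_le (X.ball_mono hle) (by omega) (X.finite_ball r)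
      have h : ∃ e : X.graph.induce (X.ball r') ≃g K, _ := h
      rw [heq] at h
      exact h
  rw [this]
  exact (measurableSet_cylinder K o hB).inter
    ((measurableSet_lt_ncard_ball r _).diff (measurableSet_lt_ncard_ball r _))

theorem isLocalEmbedding_ball (X : LabeledRootedGraph.{u} b) {r n : ℕ} {K : SimpleGraph (Fin n)}
    (e : X.graph.induce (X.ball r) ≃g K) :
    IsLocalEmbedding K X.graph (fun i => (e.symm i : X.V))
      fun i => r - X.graph.dist X.root (e.symm i) where
  injective := Subtype.val_injective.comp e.symm.injective
  map_adj i j h := e.symm.map_adj_iff.2 h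
  exists_adj i hi y hy := by
    have hd := X.connected.dist_triangle (u := X.root) (v := (e.symm i : X.V)) (w := y)
    rw [dist_eq_one_iff_adj.2 hy] at hd
    have hyr : y ∈ X.ball r := by
      change X.graph.dist X.root y ≤ r
      omega
    refine ⟨e ⟨y, hyr⟩, ?_, by simp⟩
    rw [← e.symm.map_adj_iff]
    simpa using hy
  depth i j h := by
    have h' : X.graph.Adj (e.symm i : X.V) (e.symm j) := e.symm.map_adj_iff.2 h
    have hd := X.connected.dist_triangle (u := X.root) (v := (e.symm i : X.V))
      (w := (e.symm j : X.V))
    rw [dist_eq_one_iff_adj.2 h'] at hd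
    omega

end LabeledRootedGraph

/-! ### Measurability of the resampling process -/

namespace SimpleGraph

open Finset MeasureTheory

section Measurability

theorem measurableSet_exists {Ω ι : Type*} [MeasurableSpace Ω] [Countable ι] {p : ι → Ω → Prop}
    (h : ∀ i, MeasurableSet {ω | p i ω}) : MeasurableSet {ω | ∃ i, p i ω} := by
  have : {ω | ∃ i, p i ω} = ⋃ i, {ω | p i ω} := by ext; simp
  rw [this]
  exact MeasurableSet.iUnion h

theorem measurableSet_forall {Ω ι : Type*} [MeasurableSpace Ω] [Countable ι] {p : ι → Ω → Prop}
    (h : ∀ i, MeasurableSet {ω | p i ω}) : MeasurableSet {ω | ∀ i, p i ω} := by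
  have : {ω | ∀ i, p i ω} = ⋂ i, {ω | p i ω} := by ext; simp
  rw [this]
  exact MeasurableSet.iInter h

theorem measurable_current {V A Ω : Type*} [MeasurableSpace A] [MeasurableSpace Ω] {r : Ω → V × ℕ → A} (hr : Measurable r) {c : Ω → V → ℕ}
    (hc : ∀ v, Measurable fun ω => c ω v) : Measurable fun ω v => r ω (v, c ω v) := by
  refine measurable_pi_lambda _ fun v => ?_
  intro D hD
  have : (fun ω => r ω (v, c ω v)) ⁻¹' D =
      ⋃ j, ((fun ω => c ω v) ⁻¹' {j}) ∩ ((fun ω => r ω (v, j)) ⁻¹' D) := by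
    ext ω; simp
  rw [this]
  exact MeasurableSet.iUnion fun j => (hc v (measurableSet_singleton j)).inter
    (((measurable_pi_apply (v, j)).comp hr) hD)

variable {V A Ω : Type*} {G : SimpleGraph V} [G.LocallyFinite] {Q : A → Set ℕ}
  {g : ℕ∞} [MeasurableSpace A] [DiscreteMeasurableSpace A] [MeasurableSpace Ω]

theorem measurable_neighborRank (x y : V) :
    Measurable fun f : V → unitInterval => G.neighborRank f x y := by
  classical
  have : (fun f : V → unitInterval => G.neighborRank f x y) =
      fun f => ∑ z ∈ G.neighborFinset x, if f z < f y then 1 else 0 := by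
    funext f
    rw [← Finset.card_filter, ← Set.ncard_coe_finset]
    simp [neighborRank]
  rw [this]
  refine Finset.measurable_sum _ fun z _ => Measurable.ite ?_ measurable_const measurable_const
  exact measurableSet_lt (measurable_pi_apply z) (measurable_pi_apply y)

theorem measurableSet_keptGraph_adj {a : Ω → V → unitInterval} (ha : Measurable a)
    {s : Ω → V → A} (hs : Measurable s) (x y : V) :
    MeasurableSet {ω | (G.keptGraph Q (a ω) (s ω)).Adj x y} := by
  have key : ∀ x y, MeasurableSet {ω | G.neighborRank (a ω) x y ∈ Q (s ω x)} := by
    intro x y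
    have : {ω | G.neighborRank (a ω) x y ∈ Q (s ω x)} =
        ⋃ i, ((fun ω => G.neighborRank (a ω) x y) ⁻¹' {i}) ∩
          ((fun ω => s ω x) ⁻¹' {c | i ∈ Q c}) := by
      ext ω; simp
    rw [this]
    refine MeasurableSet.iUnion fun i => MeasurableSet.inter ?_ ?_
    · exact ((measurable_neighborRank x y).comp ha) (measurableSet_singleton i)
    · exact ((measurable_pi_apply x).comp hs) MeasurableSet.of_discrete
  by_cases hxy : G.Adj x y
  · have : {ω | (G.keptGraph Q (a ω) (s ω)).Adj x y} =
        {ω | G.neighborRank (a ω) x y ∈ Q (s ω x)} ∪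
        {ω | G.neighborRank (a ω) y x ∈ Q (s ω y)} := by
      ext ω; simp [keptGraph, hxy]
    rw [this]
    exact (key x y).union (key y x)
  · have : {ω | (G.keptGraph Q (a ω) (s ω)).Adj x y} = ∅ := by
      ext ω; simp [keptGraph, hxy]
    rw [this]; exact MeasurableSet.empty

/-- Joint measurability in labels and table serves two purposes: Fubini for the termination
statement, and Borel sets of labels on finite balls. -/
theorem measurable_resampleCounter [Countable V] {a : Ω → V → unitInterval} (ha : Measurable a)
    {r : Ω → V × ℕ → A} (hr : Measurable r) (t : ℕ) (v : V) :
    Measurable fun ω => resampleCounter (G.badChoices Q g (a ω)) (a ω) (r ω) t v := by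
  induction t generalizing v with
  | zero => exact measurable_const
  | succ t ih =>
    have hcur := measurable_current hr ih
    have hact : ∀ S, MeasurableSet {ω | IsActive (resamplingSchedule t) (a ω)
        {S | (fun w => r ω (w, resampleCounter (G.badChoices Q g (a ω)) (a ω) (r ω) t w)) ∈
          G.badChoices Q g (a ω) S} S} := by
      intro S
      have h1 := measurableSet_hasCycleOn
        (fun x y => measurableSet_keptGraph_adj (G := G) (Q := Q) ha hcur x y) S
      have h2 : MeasurableSet {ω | ∀ v ∈ S, ⌊(a ω v : ℝ) * (resamplingSchedule t).2.1⌋₊ ∈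
          (resamplingSchedule t).2.2} := by
        have : {ω | ∀ v ∈ S, ⌊(a ω v : ℝ) * (resamplingSchedule t).2.1⌋₊ ∈
          (resamplingSchedule t).2.2} = ⋂ v ∈ S, (fun ω => ⌊(a ω v : ℝ) *
            (resamplingSchedule t).2.1⌋₊) ⁻¹' (resamplingSchedule t).2.2 := by
          ext ω; simp
        rw [this]
        refine Finset.measurableSet_biInter _ fun v _ => ?_
        have : Measurable fun ω => ⌊(a ω v : ℝ) * (resamplingSchedule t).2.1⌋₊ :=
          Nat.measurable_floor.comp
            ((measurable_subtype_coe.comp ((measurable_pi_apply v).comp ha)).mul_const _)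
        exact this (Finset.measurableSet _)
      exact ((MeasurableSet.const _).inter h1).inter ((MeasurableSet.const _).inter h2)
    simp only [resampleCounter]
    refine (ih v).add (Measurable.ite ?_ measurable_const measurable_const)
    have : ∀ ω, (∃ S, IsSelected (resamplingSchedule t) (a ω)
        {S | (fun w => r ω (w, resampleCounter (G.badChoices Q g (a ω)) (a ω) (r ω) t w)) ∈
          G.badChoices Q g (a ω) S} S ∧ v ∈ S) ↔ ∃ S, (IsActive (resamplingSchedule t) (a ω)
        {S | (fun w => r ω (w, resampleCounter (G.badChoices Q g (a ω)) (a ω) (r ω) t w)) ∈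
          G.badChoices Q g (a ω) S} S ∧ ∀ S', IsActive (resamplingSchedule t) (a ω)
        {S | (fun w => r ω (w, resampleCounter (G.badChoices Q g (a ω)) (a ω) (r ω) t w)) ∈
          G.badChoices Q g (a ω) S} S' → (S' ≠ S → Disjoint S' S)) ∧ v ∈ S := fun ω => Iff.rfl
    simp only [this]
    refine measurableSet_exists fun S => MeasurableSet.inter (MeasurableSet.inter (hact S) ?_)
      (MeasurableSet.const _)
    refine measurableSet_forall fun S' => ?_
    by_cases hS' : S' ≠ S → Disjoint S' S
    · convert MeasurableSet.univ using 1
      exact Set.eq_univ_of_forall fun ω _ => hS'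
    · convert (hact S').compl using 1
      ext ω
      exact ⟨fun h hω => hS' (h hω), fun h hω => absurd hω h⟩

theorem measurableSet_keepsPosition [Countable V] {α : unitInterval → unitInterval} (hα : Measurable α)
    {τ : unitInterval → ℕ → A} (hτ : Measurable τ) (t : ℕ) (x : V) (i : ℕ) :
    MeasurableSet {f : V → unitInterval | G.KeepsPosition Q g α τ f t x i} := by
  have ha : Measurable fun f : V → unitInterval => α ∘ f :=
    measurable_pi_lambda _ fun v => hα.comp (measurable_pi_apply v)
  have hr : Measurable fun (f : V → unitInterval) (p : V × ℕ) => τ (f p.1) p.2 :=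
    measurable_pi_lambda _ fun p =>
      (measurable_pi_apply p.2).comp (hτ.comp (measurable_pi_apply p.1))
  refine measurableSet_exists fun y => MeasurableSet.inter ?_ ?_
  · exact measurableSet_keptGraph_adj ha (measurable_current hr
      fun v => measurable_resampleCounter ha hr t v) x y
  · exact measurable_neighborRank x y (measurableSet_singleton i)

/-- By locality the event is decided on a ball of radius `resamplingRadius t + 2`. There are
countably many finite rooted graphs, each with a Borel set of labels. -/
theorem measurableSet_keepsPosition_root {b : ℕ} {α : unitInterval → unitInterval}
    (hα : Measurable α) {τ : unitInterval → ℕ → A} (hτ : Measurable τ) (t i : ℕ) :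
    MeasurableSet {X : LabeledRootedGraph.{u} b |
      X.graph.KeepsPosition Q g α τ X.label t X.root i} := by
  set N := resamplingRadius t + 2 with hN
  have : {X : LabeledRootedGraph.{u} b | X.graph.KeepsPosition Q g α τ X.label t X.root i} =
      ⋃ (n : ℕ) (K : SimpleGraph (Fin n)) (o : Fin n), LabeledRootedGraph.ballCylinder b N K o
        {l | K.KeepsPosition Q g α τ l t o i} := by
    have key : ∀ (X : LabeledRootedGraph.{u} b) (n : ℕ) (K : SimpleGraph (Fin n)) (o : Fin n)
        (e : X.graph.induce (X.ball N) ≃g K), (e.symm o : X.V) = X.root →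
        (X.graph.KeepsPosition Q g α τ X.label t X.root i ↔
          K.KeepsPosition Q g α τ (fun i => X.label (e.symm i : X.V)) t o i) := by
      intro X n K o e he
      rw [← he]
      refine (X.isLocalEmbedding_ball e).keepsPosition_iff X.label ?_ i
      rw [he, dist_self, Nat.sub_zero]
    ext X
    simp only [Set.mem_ofPred_eq, Set.mem_iUnion]
    constructor
    · intro h
      obtain ⟨n, K, o, e, he⟩ := X.exists_mem_ballCylinder N
      exact ⟨n, K, o, e, he, (key X n K o e he).1 h⟩
    · rintro ⟨n, K, o, e, he, h⟩
      exact (key X n K o e he).2 h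
  rw [this]
  refine MeasurableSet.iUnion fun n => MeasurableSet.iUnion fun K => MeasurableSet.iUnion fun o =>
    LabeledRootedGraph.measurableSet_ballCylinder N K o ?_
  have : K.LocallyFinite := fun v => Fintype.ofFinite _
  exact measurableSet_keepsPosition hα hτ t o i

end Measurability

end SimpleGraph

/-! ### Decoding one uniform label into independent randomness -/

section Decoding

open MeasureTheory ProbabilityTheory

/-- The product measure over a disjoint union is the product of the product measures. -/
theorem infinitePi_map_sum {ι κ X : Type*} [MeasurableSpace X] (μ : Measure X)
    [IsProbabilityMeasure μ] :
    (Measure.infinitePi fun _ : ι ⊕ κ => μ).map (fun x => (fun i => x (.inl i), fun j => x (.inr j))) =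
      (Measure.infinitePi fun _ : ι => μ).prod (Measure.infinitePi fun _ : κ => μ) := by
  classical
  have hm1 : Measurable fun x : ι ⊕ κ → X => (fun i => x (.inl i), fun j => x (.inr j)) := by
    fun_prop
  have hm2 : Measurable fun p : (ι → X) × (κ → X) => (Sum.elim p.1 p.2 : ι ⊕ κ → X) := by
    refine measurable_pi_lambda _ fun i => ?_
    cases i
    · exact (measurable_pi_apply _).comp measurable_fst
    · exact (measurable_pi_apply _).comp measurable_snd
  have h : ((Measure.infinitePi fun _ : ι => μ).prod (Measure.infinitePi fun _ : κ => μ)).map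
      (fun p => (Sum.elim p.1 p.2 : ι ⊕ κ → X)) = Measure.infinitePi fun _ : ι ⊕ κ => μ := by
    refine Measure.eq_infinitePi _ fun s t ht => ?_
    rw [Measure.map_apply hm2 (MeasurableSet.pi s.countable_toSet fun i _ => ht i)]
    have hset : (fun p : (ι → X) × (κ → X) => (Sum.elim p.1 p.2 : ι ⊕ κ → X)) ⁻¹'
        (s : Set (ι ⊕ κ)).pi t =
        ((s.toLeft : Set ι).pi fun i => t (.inl i)) ×ˢ
          ((s.toRight : Set κ).pi fun j => t (.inr j)) := by
      ext p
      simp [Set.mem_pi]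
    rw [hset, Measure.prod_prod, Measure.infinitePi_pi _ fun i _ => ht _,
      Measure.infinitePi_pi _ fun i _ => ht _]
    conv_rhs => rw [← Finset.toLeft_disjSum_toRight (u := s), Finset.prod_disjSum]
  rw [← h, Measure.map_map hm1 hm2]
  exact Measure.map_id

/-- A uniform label in `[0,1]` can be decoded into a uniform label and an independent sequence of
independent variables with law `ν`. -/
theorem exists_decoding {A : Type*} [MeasurableSpace A] [StandardBorelSpace A] [Nonempty A]
    (ν : Measure A) [IsProbabilityMeasure ν] :
    ∃ (α : unitInterval → unitInterval) (τ : unitInterval → ℕ → A), Measurable α ∧ Measurable τ ∧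
      ∀ V : Type u, (iidLabels V).map (fun f => (α ∘ f, fun p : V × ℕ => τ (f p.1) p.2)) =
        (iidLabels V).prod (Measure.infinitePi fun _ : V × ℕ => ν) := by
  obtain ⟨θ, hθ, hθμ⟩ := Measure.exists_measurable_map_eq
    (Measure.infinitePi fun _ : ℕ => (volume : Measure unitInterval))
  obtain ⟨h, hh, hν⟩ := Measure.exists_measurable_map_eq ν
  refine ⟨fun x => θ x 0, fun x j => h (θ x (j + 1)), (measurable_pi_apply 0).comp hθ,
    measurable_pi_lambda _ fun j => hh.comp ((measurable_pi_apply _).comp hθ), fun V => ?_⟩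
  have h1 : (iidLabels V).map (fun f v => θ (f v)) = Measure.infinitePi fun _ : V =>
      Measure.infinitePi fun _ : ℕ => (volume : Measure unitInterval) := by
    rw [iidLabels, Measure.infinitePi_map_pi _ fun _ => hθ]
    simp_rw [hθμ]
  have h2 : (iidLabels V).map (fun f (p : V × ℕ) => θ (f p.1) p.2) =
      Measure.infinitePi fun _ : V × ℕ => (volume : Measure unitInterval) := by
    rw [← Measure.infinitePi_map_curry_symm fun (_ : V) (_ : ℕ) => (volume : Measure unitInterval),
      ← h1, Measure.map_map (by fun_prop) (by fun_prop)]
    rfl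
  -- Coordinate 0 of a decoded sequence is the selection label; the coordinates from 1 on become the
  -- table.
  let e : V ⊕ V × ℕ → V × ℕ := Sum.elim (fun v => (v, 0)) fun p => (p.1, p.2 + 1)
  have he : Function.Injective e := by
    rintro (v | ⟨v, j⟩) (w | ⟨w, k⟩) hvw <;> simp [e] at hvw ⊢
    · exact hvw
    · exact hvw
  have h3 := Measure.map_infinitePi_infinitePi_of_inj
    (P := fun _ : V × ℕ => (volume : Measure unitInterval)) he
  have hid : Measurable fun (f : V → unitInterval) (p : V × ℕ) => θ (f p.1) p.2 :=
    measurable_pi_lambda _ fun p => (measurable_pi_apply _).comp (hθ.comp (measurable_pi_apply _))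
  have hhm : Measurable fun (x : V × ℕ → unitInterval) (p : V × ℕ) => h (x p) :=
    measurable_pi_lambda _ fun p => hh.comp (measurable_pi_apply _)
  have h4 := infinitePi_map_sum (ι := V) (κ := V × ℕ) (volume : Measure unitInterval)
  have h4' := congrArg (Measure.map fun ω (i : V ⊕ V × ℕ) => ω (e i)) h2
  rw [← h3, ← h4', Measure.map_map (by fun_prop) hid,
    Measure.map_map (by fun_prop) (by fun_prop)] at h4
  have h5 : Measure.infinitePi (fun _ : V × ℕ => ν) =
      (Measure.infinitePi fun _ : V × ℕ => (volume : Measure unitInterval)).map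
        fun x p => h (x p) := by
    rw [Measure.infinitePi_map_pi _ fun _ => hh]
    simp_rw [hν]
  have h6 := Measure.map_prod_map (Measure.infinitePi fun _ : V => (volume : Measure unitInterval))
    (Measure.infinitePi fun _ : V × ℕ => (volume : Measure unitInterval)) measurable_id hhm
  rw [Measure.map_id, ← h5, ← h4, Measure.map_map (by fun_prop) (by fun_prop)] at h6
  rw [iidLabels] at h6 ⊢
  rw [h6]
  rfl

theorem ae_injective_iidLabels (V : Type u) [Countable V] :
    ∀ᵐ f ∂(iidLabels V), Function.Injective f := by
  have key : ∀ v w : V, v ≠ w → ∀ᵐ f ∂(iidLabels V), f v ≠ f w := by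
    intro v w hvw
    have hdiag : MeasurableSet (Set.diagonal unitInterval) := measurableSet_diagonal
    have h0 : ((volume : Measure unitInterval).prod volume) (Set.diagonal unitInterval) = 0 := by
      rw [Measure.prod_apply hdiag]
      have : ∀ x : unitInterval, Prod.mk x ⁻¹' Set.diagonal unitInterval = {x} := by
        intro x; ext y; simp [eq_comm]
      simp [this]
    rw [← Measure.infinitePi_map_eval_prod (P := fun _ : V => (volume : Measure unitInterval)) hvw,
      Measure.map_apply (by fun_prop) hdiag] at h0
    rw [ae_iff]
    simpa [iidLabels, Set.preimage, Set.mem_diagonal_iff] using h0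
  have : ∀ᵐ f ∂(iidLabels V), ∀ v w : V, v ≠ w → f v ≠ f w := by
    rw [ae_all_iff]; intro v
    rw [ae_all_iff]; intro w
    by_cases h : v = w
    · simp [h]
    · simpa [h] using key v w h
  filter_upwards [this] with f hf v w h
  by_contra hne
  exact hf v w hne h

end Decoding

/-! ### The random choice of δ positions -/

section Choices

open MeasureTheory ProbabilityTheory
open scoped ENNReal

/-- The uniform distribution on the functions from `Fin δ` to `Fin m`. -/
noncomputable def uniformChoices (δ m : ℕ) [NeZero m] : Measure (Fin δ → Fin m) :=
  Measure.infinitePi fun _ => (PMF.uniformOfFintype (Fin m)).toMeasure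

/-- The positions that are picked by the choice `c`: one from each of `δ` consecutive intervals of
length `m`. -/
def pickedPositions {δ m : ℕ} (c : Fin δ → Fin m) : Set ℕ :=
  Set.range fun j : Fin δ => (j : ℕ) * m + c j

instance (δ m : ℕ) [NeZero m] : IsProbabilityMeasure (uniformChoices δ m) := by
  unfold uniformChoices; infer_instance

variable {δ m : ℕ}

theorem mem_pickedPositions_iff {c : Fin δ → Fin m} {i : ℕ} :
    i ∈ pickedPositions c ↔ ∃ j : Fin δ, (j : ℕ) = i / m ∧ (c j : ℕ) = i % m := by
  constructor
  · rintro ⟨j, rfl⟩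
    refine ⟨j, ?_, ?_⟩
    · simp only
      rw [mul_comm, Nat.mul_add_div (by have := (c j).2; omega), Nat.div_eq_of_lt (c j).2, add_zero]
    · simp only
      rw [mul_comm, Nat.mul_add_mod, Nat.mod_eq_of_lt (c j).2]
  · rintro ⟨j, h1, h2⟩
    exact ⟨j, by simp only [h1, h2]; exact Nat.div_add_mod' i m⟩

theorem pickedPositions_subset {d : ℕ} (h : δ * m ≤ d) (c : Fin δ → Fin m) :
    pickedPositions c ⊆ Set.Iio d := by
  rintro _ ⟨j, rfl⟩
  have h1 : ((j : ℕ) + 1) * m ≤ δ * m := Nat.mul_le_mul_right m j.2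
  have h2 := (c j).2
  rw [add_mul, one_mul] at h1
  change (j : ℕ) * m + c j < d
  omega

theorem le_encard_pickedPositions (c : Fin δ → Fin m) : (δ : ℕ∞) ≤ (pickedPositions c).encard := by
  have hinj : Function.Injective fun j : Fin δ => (j : ℕ) * m + c j := by
    intro j j' h
    have h : (j : ℕ) * m + c j = j' * m + c j' := h
    have h' := congrArg (· / m) h
    have hm : 0 < m := by have := (c j).2; omega
    simp only [mul_comm _ m, Nat.mul_add_div hm, Nat.div_eq_of_lt (c _).2, add_zero] at h'
    exact Fin.ext h'
  rw [pickedPositions]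
  simpa using hinj.encard_range

variable [NeZero m]

theorem uniformOfFintype_singleton (b : Fin m) :
    (PMF.uniformOfFintype (Fin m)).toMeasure {b} = (m : ℝ≥0∞)⁻¹ := by
  rw [PMF.toMeasure_apply_singleton _ _ (measurableSet_singleton b), PMF.uniformOfFintype_apply,
    Fintype.card_fin]

theorem uniformChoices_mem_pickedPositions_le (i : ℕ) :
    uniformChoices δ m {c | i ∈ pickedPositions c} ≤ (m : ℝ≥0∞)⁻¹ := by
  by_cases hi : i / m < δ
  · have hsub : {c : Fin δ → Fin m | i ∈ pickedPositions c} ⊆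
        (fun c => c ⟨i / m, hi⟩) ⁻¹' {⟨i % m, Nat.mod_lt _ (NeZero.pos m)⟩} := by
      intro c hc
      obtain ⟨j, h1, h2⟩ := mem_pickedPositions_iff.1 hc
      obtain rfl : j = ⟨i / m, hi⟩ := Fin.ext h1
      exact Fin.ext h2
    refine (measure_mono hsub).trans ?_
    rw [uniformChoices, ← Measure.map_apply (by fun_prop) (measurableSet_singleton _),
      Measure.infinitePi_map_eval, uniformOfFintype_singleton]
  · have : {c : Fin δ → Fin m | i ∈ pickedPositions c} = ∅ := by
      refine Set.eq_empty_of_forall_notMem fun c hc => ?_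
      obtain ⟨j, h1, h2⟩ := mem_pickedPositions_iff.1 hc
      exact hi (h1 ▸ j.2)
    rw [this]; simp

/-- Positions in different blocks are picked independently; two positions in the same block are
never both picked. -/
theorem uniformChoices_mem_pickedPositions_pair_le (i i' : ℕ) (hne : i ≠ i') :
    uniformChoices δ m {c | i ∈ pickedPositions c ∧ i' ∈ pickedPositions c} ≤
      (m : ℝ≥0∞)⁻¹ * (m : ℝ≥0∞)⁻¹ := by
  by_cases hi : i / m < δ ∧ i' / m < δ ∧ i / m ≠ i' / m
  · obtain ⟨hi, hi', hdiv⟩ := hi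
    have hjj : (⟨i / m, hi⟩ : Fin δ) ≠ ⟨i' / m, hi'⟩ := fun h => hdiv (congrArg Fin.val h)
    have hsub : {c : Fin δ → Fin m | i ∈ pickedPositions c ∧ i' ∈ pickedPositions c} ⊆
        (fun c => (c ⟨i / m, hi⟩, c ⟨i' / m, hi'⟩)) ⁻¹'
          ({⟨i % m, Nat.mod_lt _ (NeZero.pos m)⟩} ×ˢ {⟨i' % m, Nat.mod_lt _ (NeZero.pos m)⟩}) := by
      rintro c ⟨hc, hc'⟩
      obtain ⟨j, h1, h2⟩ := mem_pickedPositions_iff.1 hc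
      obtain ⟨j', h1', h2'⟩ := mem_pickedPositions_iff.1 hc'
      obtain rfl : j = ⟨i / m, hi⟩ := Fin.ext h1
      obtain rfl : j' = ⟨i' / m, hi'⟩ := Fin.ext h1'
      exact ⟨Fin.ext h2, Fin.ext h2'⟩
    refine (measure_mono hsub).trans ?_
    rw [uniformChoices, ← Measure.map_apply (by fun_prop)
      ((measurableSet_singleton _).prod (measurableSet_singleton _)),
      Measure.infinitePi_map_eval_prod hjj, Measure.prod_prod, uniformOfFintype_singleton,
      uniformOfFintype_singleton]
  · have : {c : Fin δ → Fin m | i ∈ pickedPositions c ∧ i' ∈ pickedPositions c} = ∅ := by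
      refine Set.eq_empty_of_forall_notMem fun c hc => ?_
      obtain ⟨j, h1, h2⟩ := mem_pickedPositions_iff.1 hc.1
      obtain ⟨j', h1', h2'⟩ := mem_pickedPositions_iff.1 hc.2
      refine hi ⟨h1 ▸ j.2, h1' ▸ j'.2, fun h => hne ?_⟩
      obtain rfl : j = j' := Fin.ext (by rw [h1, h1', h])
      rw [← Nat.div_add_mod i m, ← Nat.div_add_mod i' m, h, ← h2, ← h2']
    rw [this]; simp

end Choices

/-! ### The limit of the process -/

namespace SimpleGraph

open MeasureTheory ProbabilityTheory
open scoped ENNReal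

section Main

variable {V : Type u} {A : Type*} {G : SimpleGraph V} {g : ℕ∞} {Q : A → Set ℕ}
  {α : unitInterval → unitInterval} {τ : unitInterval → ℕ → A}

open Classical in
/-- The set of positions that are kept from some time on. -/
noncomputable def eventuallyKept (Q : A → Set ℕ) (g : ℕ∞) (α : unitInterval → unitInterval)
    (τ : unitInterval → ℕ → A) {d : ℕ} (X : LabeledRootedGraph.{u} d) (i : Fin d) : Bool :=
  decide (∃ T, ∀ t ≥ T, X.graph.KeepsPosition Q g α τ X.label t X.root i)

theorem isRandomizedLocalBorel_eventuallyKept [MeasurableSpace A] [DiscreteMeasurableSpace A]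
    (hα : Measurable α) (hτ : Measurable τ) {d : ℕ} :
    IsRandomizedLocalBorel fun X : LabeledRootedGraph.{u} d => eventuallyKept Q g α τ X := by
  have h : Measurable fun X : LabeledRootedGraph.{u} d => eventuallyKept Q g α τ X := by
    refine measurable_pi_lambda _ fun i => measurable_to_bool ?_
    have : (fun X : LabeledRootedGraph.{u} d => eventuallyKept Q g α τ X i) ⁻¹' {true} =
        {X | ∃ T, ∀ t, t ≥ T → X.graph.KeepsPosition Q g α τ X.label t X.root i} := by
      ext X; simp [eventuallyKept]
    rw [this]
    refine measurableSet_exists fun T => measurableSet_forall fun t => ?_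
    by_cases ht : t ≥ T
    · simpa [ht] using measurableSet_keepsPosition_root hα hτ t i
    · simp [ht]
  rw [IsRandomizedLocalBorel]
  convert h
  exact BorelSpace.measurable_eq.symm

/-- By Fubini the selection labels may be fixed, almost surely distinct. The bad events then depend
on the table alone, and the termination criterion applies. -/
theorem ae_exists_eventually_eq [Countable V] [G.LocallyFinite] [MeasurableSpace A]
    [DiscreteMeasurableSpace A] (ν : Measure A) [IsProbabilityMeasure ν]
    {d δ : ℕ} (hδ : 0 < δ) (hG : G.FewShortCycles d δ g)
    (h1 : ∀ i, ν {c | i ∈ Q c} ≤ ((d / δ : ℕ) : ℝ≥0∞)⁻¹)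
    (h2 : ∀ i j, i ≠ j →
      ν {c | i ∈ Q c ∧ j ∈ Q c} ≤ ((d / δ : ℕ) : ℝ≥0∞)⁻¹ * ((d / δ : ℕ) : ℝ≥0∞)⁻¹) :
    ∀ᵐ p ∂(iidLabels V).prod (Measure.infinitePi fun _ : V × ℕ => ν),
      ∀ v, ∃ T, ∀ t ≥ T, resampleCounter (G.badChoices Q g p.1) p.1 p.2 t v =
        resampleCounter (G.badChoices Q g p.1) p.1 p.2 T v := by
  classical
  have : IsProbabilityMeasure (iidLabels V) := by unfold iidLabels; infer_instance
  have hm : MeasurableSet {p : (V → unitInterval) × (V × ℕ → A) |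
      ∀ v, ∃ T, ∀ t, t ≥ T → resampleCounter (G.badChoices Q g p.1) p.1 p.2 t v =
        resampleCounter (G.badChoices Q g p.1) p.1 p.2 T v} := by
    refine measurableSet_forall fun v => measurableSet_exists fun T => measurableSet_forall
      fun t => ?_
    by_cases ht : t ≥ T
    · simp only [ht, true_imp_iff]
      exact measurableSet_eq_fun (measurable_resampleCounter measurable_fst measurable_snd t v)
        (measurable_resampleCounter measurable_fst measurable_snd T v)
    · simp [ht]
  refine (Measure.ae_prod_mem_iff_ae_ae_mem hm).2 ?_
  filter_upwards [ae_injective_iidLabels V] with a ha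
  have hsum : ∀ v, ∑' S : Finset V, (if v ∈ S then
      G.cycleWeight g ((d / δ : ℕ) : ℝ≥0∞)⁻¹ S * 2 ^ S.card else 0) ≤ 1 := fun v => by
    convert tsum_cycleWeight_le_one hδ hG v
  filter_upwards [ae_forall_isResampling_eventually_eq ν
    (fun S => measurableSet_badChoices (G := G) (Q := Q) (g := g) (a := a) S)
    dependsOnlyOn_badChoices _ (fun S => measure_badChoices_le h1 h2 ha S) hsum] with r hr
  exact hr _ _ isResampling_resampleCounter

/-- If the counters stabilise, then the edges that are kept from some time on form a subgraph
with the required properties. -/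
theorem exists_isGivenBy [G.LocallyFinite] {d δ : ℕ} (hG : G.IsRegularOfDegree d)
    (hQ : ∀ c, (δ : ℕ∞) ≤ (Q c ∩ Set.Iio d).encard) {f : V → unitInterval}
    (hf : Function.Injective f) (hαf : Function.Injective (α ∘ f))
    (hc : ∀ v, ∃ T, ∀ t ≥ T,
      resampleCounter (G.badChoices Q g (α ∘ f)) (α ∘ f) (fun p => τ (f p.1) p.2) t v =
        resampleCounter (G.badChoices Q g (α ∘ f)) (α ∘ f) (fun p => τ (f p.1) p.2) T v) :
    ∃ H : SimpleGraph V, G.IsGivenBy hG.encard_neighborSet_le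
      (fun X : LabeledRootedGraph.{u} d => eventuallyKept Q g α τ X) f H ∧
        G.IsLargeGirthSpanningSubgraph δ g H := by
  choose T hT using hc
  set s : V → A := fun v => τ (f v)
    (resampleCounter (G.badChoices Q g (α ∘ f)) (α ∘ f) (fun p => τ (f p.1) p.2) (T v) v) with hs
  set H := G.keptGraph Q (α ∘ f) s with hH
  have hkept : ∀ x y, ∀ t ≥ max (T x) (T y), (G.keptAt Q g α τ f t).Adj x y ↔ H.Adj x y := by
    intro x y t ht
    simp only [keptAt, hH, keptGraph, hs, hT x t ((le_max_left _ _).trans ht),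
      hT y t ((le_max_right _ _).trans ht)]
  refine ⟨H, fun x y => ?_, keptGraph_le s, ?_, fun v =>
    le_encard_neighborSet_keptGraph hG hQ hαf s v⟩
  · have hev : ∀ i : Fin d, eventuallyKept Q g α τ
        (G.rootedComponent hG.encard_neighborSet_le f x) i = true ↔
        ∃ T, ∀ t ≥ T, G.KeepsPosition Q g α τ f t x i := by
      intro i
      simp only [eventuallyKept, decide_eq_true_eq, keepsPosition_rootedComponent]
    simp only [hev]
    constructor
    · intro hxy
      refine ⟨hxy.1, ⟨G.neighborRank f x y, ?_⟩, rfl, max (T x) (T y), fun t ht =>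
        ⟨y, (hkept x y t ht).2 hxy, rfl⟩⟩
      rw [← hG x]
      exact neighborRank_lt_degree hxy.1
    · rintro ⟨hxy, i, hi, T', hT'⟩
      -- At a time after stabilisation the kept neighbour in position `i` must be `y`, as positions
      -- with respect to `f` are distinct.
      obtain ⟨z, hz, hzi⟩ := hT' (max T' (max (T x) (T y))) (le_max_left _ _)
      have : z = y := neighborRank_injOn hf x hz.1 hxy (by rw [hzi, hi])
      subst this
      exact (hkept x z _ (le_max_right _ _)).1 hz
  · refine le_egirth_of_forall_not_hasCycleOn fun S hS hcyc => ?_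
    have hne : S.Nonempty := Finset.card_pos.1 (by have := hcyc.1; omega)
    exact notMem_bad_of_eventually_eq (r := fun p => τ (f p.1) p.2) dependsOnlyOn_badChoices hαf
      finite_setOf_badChoices_nonempty (fun v => ⟨T v, hT v⟩) hne ⟨hS, hcyc⟩

end Main

end SimpleGraph

open MeasureTheory in
/-- Resampling the bad cycles as a randomized local Borel function. -/
theorem exists_randomizedLocalBorel_isLargeGirthSpanningSubgraph (d δ : ℕ) (hδ : 0 < δ)
    (hδd : δ ≤ d) (g : ℕ∞) :
    ∃ φ : LabeledRootedGraph.{u} d → (Fin d → Bool), IsRandomizedLocalBorel φ ∧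
      ∀ (V : Type u) [Countable V] (G : SimpleGraph V) [G.LocallyFinite]
        (hG : G.IsRegularOfDegree d), G.FewShortCycles d δ g →
          ∀ᵐ f ∂(iidLabels V), ∃ H : SimpleGraph V,
            G.IsGivenBy hG.encard_neighborSet_le φ f H ∧
              G.IsLargeGirthSpanningSubgraph δ g H := by
  have hm : 0 < d / δ := Nat.div_pos hδd hδ
  have : NeZero (d / δ) := ⟨hm.ne'⟩
  obtain ⟨α, τ, hα, hτ, hlaw⟩ := exists_decoding.{u} (uniformChoices δ (d / δ))
  refine ⟨fun X => SimpleGraph.eventuallyKept pickedPositions g α τ X,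
    SimpleGraph.isRandomizedLocalBorel_eventuallyKept hα hτ, ?_⟩
  intro V _ G _ hG hfew
  have : IsProbabilityMeasure (iidLabels V) := by unfold iidLabels; infer_instance
  have hmeas : Measurable fun f : V → unitInterval =>
      (α ∘ f, fun p : V × ℕ => τ (f p.1) p.2) := by
    refine Measurable.prodMk (measurable_pi_lambda _ fun v => hα.comp (measurable_pi_apply v)) ?_
    exact measurable_pi_lambda _ fun p =>
      (measurable_pi_apply p.2).comp (hτ.comp (measurable_pi_apply p.1))
  have hstab := SimpleGraph.ae_exists_eventually_eq (G := G) (uniformChoices δ (d / δ)) hδ hfew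
    uniformChoices_mem_pickedPositions_le uniformChoices_mem_pickedPositions_pair_le
  have hinj : ∀ᵐ p ∂(iidLabels V).prod
      (Measure.infinitePi fun _ : V × ℕ => uniformChoices δ (d / δ)), Function.Injective p.1 :=
    Measure.quasiMeasurePreserving_fst.ae (ae_injective_iidLabels V)
  rw [← hlaw V] at hstab hinj
  filter_upwards [ae_of_ae_map hmeas.aemeasurable hstab, ae_of_ae_map hmeas.aemeasurable hinj,
    ae_injective_iidLabels V] with f h1 h2 h3
  refine SimpleGraph.exists_isGivenBy hG (fun c => ?_) h3 h2 h1
  rw [Set.inter_eq_self_of_subset_left (pickedPositions_subset (Nat.mul_div_le d δ) c)]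
  exact le_encard_pickedPositions c

theorem theorem6 (d δ : ℕ) (hδ : 0 < δ) (hδd : δ ≤ d) (g : ℕ∞) :
    (∀ (V : Type u) [Countable V] (G : SimpleGraph V) [G.LocallyFinite],
      G.IsRegularOfDegree d → G.FewShortCycles d δ g →
        ∃ H : SimpleGraph V, G.IsLargeGirthSpanningSubgraph δ g H) ∧
    ∃ φ : LabeledRootedGraph.{u} d → (Fin d → Bool), IsRandomizedLocalBorel φ ∧
      ∀ (V : Type u) [Countable V] (G : SimpleGraph V) [G.LocallyFinite]
        (hG : G.IsRegularOfDegree d), G.FewShortCycles d δ g →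
          ∀ᵐ f ∂(iidLabels V), ∃ H : SimpleGraph V,
            G.IsGivenBy hG.encard_neighborSet_le φ f H ∧
              G.IsLargeGirthSpanningSubgraph δ g H := by
  obtain ⟨φ, hφ, h⟩ :=
    exists_randomizedLocalBorel_isLargeGirthSpanningSubgraph.{u} d δ hδ hδd g
  refine ⟨fun V _ G _ hG hfew => ?_, φ, hφ, h⟩
  have : MeasureTheory.IsProbabilityMeasure (iidLabels V) := by
    unfold iidLabels; infer_instance
  obtain ⟨f, H, -, hH⟩ := (h V G hG hfew).exists
  exact ⟨H, hH⟩
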